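/- Let $\mathrm{PA}$ be first-order Peano arithmetic. A \emph{universal} ($\Pi_1$) sentence is a block of universal quantifiers followed by a formula with bounded quantifiers only; existential ($\Sigma_1$) formulas are defined in the same way. Binary strings are identified with natural numbers in the standard way (the string $s$ corresponds to the number $m$ such that $m+1$ has binary expansion $1s$). A \emph{programming language} is a $\Sigma_1$ formula $U(p,x)$ ("the program $p$ terminates with output $x$") such that $\mathrm{PA}$ proves that every $p$ has at most one output; it is \emph{prefix-free} if $\mathrm{PA}$ proves that no terminating program is a proper prefix of another terminating program. The language $U$ is \emph{optimal} if for every programming language $V$ there is a constant $c$ such that $\mathrm{PA}$ proves: whenever $V(p,x)$, there is a $q$ of length at most $|p|+c$ with $U(q,x)$. A prefix-free language is \emph{optimal among prefix-free languages} if this holds for every prefix-free $V$. Let $\mathrm{K}(x)$ be the minimal length of a program $p$ for which $U(p,x)$ is true, and, for numerals $k$, let "$\mathrm{K}(x)=k$" and "$\mathrm{K}(x)>k$" be the arithmetical sentences that express these statements through $U$. Let $U$ be an optimal programming language (so that $\mathrm{K}$ is plain Kolmogorov complexity), or a prefix-free language that is optimal among prefix-free languages (so that $\mathrm{K}$ is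 prefix complexity). Then: (1) The theory obtained from $\mathrm{PA}$ by adding, for each binary string $x$, the axiom "$\mathrm{K}(x)=k$", where $k$ is the numeral for the true complexity of $x$, has the same theorems as the theory obtained from $\mathrm{PA}$ by adding all universal sentences that are true in $\mathbb{N}$. (2) The same holds if, instead, for each string $x$ with $\mathrm{K}(x)>0$ one only adds some true axiom "$\mathrm{K}(x)>c_x$", where $c_x\ge \mathrm{K}(x)/2$; here $c_x$ are arbitrary real numbers with $\mathrm{K}(x)/2\le c_x<\mathrm{K}(x)$, and "$\mathrm{K}(x)>c_x$" is written as "$\mathrm{K}(x)>\lfloor c_x\rfloor$". -/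

import Mathlib

namespace KolmogorovArithmetic

open FirstOrder FirstOrder.Language

/-! ### First-order arithmetic -/

/-- Function symbols of arithmetic: `0`, `S`, `+`, `·`. -/
inductive ArithFunc : ℕ → Type
  | zero : ArithFunc 0
  | succ : ArithFunc 1
  | add : ArithFunc 2
  | mul : ArithFunc 2

/-- Relation symbols of arithmetic (besides equality): `≤`. -/
inductive ArithRel : ℕ → Type
  | le : ArithRel 2

/-- The first-order language of arithmetic `0, S, +, ·, ≤`. -/
def arith : FirstOrder.Language.{0, 0} where
  Functions := ArithFunc
  Relations := ArithRel

/-- The standard model. -/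
instance : arith.Structure ℕ where
  funMap := fun {_} f => match f with
    | ArithFunc.zero => fun _ => 0
    | ArithFunc.succ => fun v => v 0 + 1
    | ArithFunc.add => fun v => v 0 + v 1
    | ArithFunc.mul => fun v => v 0 * v 1
  RelMap := fun {_} r => match r with
    | ArithRel.le => fun v => v 0 ≤ v 1

section Terms

variable {β : Type}

/-- The term `0`. -/
def tZero : arith.Term β := Constants.term (L := arith) ArithFunc.zero

/-- The term `S t`. -/
def tSucc (t : arith.Term β) : arith.Term β := Functions.apply₁ (L := arith) ArithFunc.succ t

/-- The term `s + t`. -/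
def tAdd (s t : arith.Term β) : arith.Term β := Functions.apply₂ (L := arith) ArithFunc.add s t

/-- The term `s · t`. -/
def tMul (s t : arith.Term β) : arith.Term β := Functions.apply₂ (L := arith) ArithFunc.mul s t

/-- The numeral `S(S(…S(0)…))` denoting `m`. -/
def numeral : ℕ → arith.Term β
  | 0 => tZero
  | m + 1 => tSucc (numeral m)

end Terms

section Formulas

variable {α : Type} {n : ℕ}

/-- The formula `s ≤ t`. -/
def fLe (s t : arith.Term (α ⊕ Fin n)) : arith.BoundedFormula α n :=
  Relations.boundedFormula₂ (L := arith) ArithRel.le s t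

/-- The formula `s < t`, that is, `S s ≤ t`. -/
def fLt (s t : arith.Term (α ⊕ Fin n)) : arith.BoundedFormula α n := fLe (tSucc s) t

/-- The formula `s = t`. -/
def fEq (s t : arith.Term (α ⊕ Fin n)) : arith.BoundedFormula α n := Term.bdEqual s t

/-- The formula `U(s, t)`, where `U` is a formula with two free variables. -/
def app₂ (U : arith.Formula (Fin 2)) (s t : arith.Term (α ⊕ Fin n)) : arith.BoundedFormula α n :=
  BoundedFormula.relabel (n := n) (k := 0) id
    (BoundedFormula.subst U (![s, t] : Fin 2 → arith.Term (α ⊕ Fin n)))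

/-- A term regarded as a term in one more bound variable (in which it does not occur). -/
def liftTerm (t : arith.Term (α ⊕ Fin n)) : arith.Term (α ⊕ Fin (n + 1)) :=
  t.relabel (Sum.map id Fin.castSucc)

/-- Bounded formulas (`Δ₀`): all quantifiers are of the form `∀ y ≤ t` or `∃ y ≤ t`, where `y` does
not occur in the term `t`. -/
inductive IsDelta0 : ∀ {n : ℕ}, arith.BoundedFormula α n → Prop
  | falsum {n : ℕ} : IsDelta0 (BoundedFormula.falsum (n := n))
  | equal {n : ℕ} (s t : arith.Term (α ⊕ Fin n)) : IsDelta0 (BoundedFormula.equal s t)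
  | rel {n l : ℕ} (R : arith.Relations l) (ts : Fin l → arith.Term (α ⊕ Fin n)) :
      IsDelta0 (BoundedFormula.rel R ts)
  | imp {n : ℕ} {φ ψ : arith.BoundedFormula α n} :
      IsDelta0 φ → IsDelta0 ψ → IsDelta0 (φ.imp ψ)
  | ball {n : ℕ} (t : arith.Term (α ⊕ Fin n)) {φ : arith.BoundedFormula α (n + 1)} :
      IsDelta0 φ → IsDelta0 (∀' (fLe (&(Fin.last n)) (liftTerm t) ⟹ φ))
  | bex {n : ℕ} (t : arith.Term (α ⊕ Fin n)) {φ : arith.BoundedFormula α (n + 1)} :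
      IsDelta0 φ → IsDelta0 (∃' (fLe (&(Fin.last n)) (liftTerm t) ⊓ φ))

/-- Existential (`Σ₁`) formulas: a block of existential quantifiers before a bounded formula. -/
inductive IsSigma1 : ∀ {n : ℕ}, arith.BoundedFormula α n → Prop
  | of_delta0 {n : ℕ} {φ : arith.BoundedFormula α n} : IsDelta0 φ → IsSigma1 φ
  | ex {n : ℕ} {φ : arith.BoundedFormula α (n + 1)} : IsSigma1 φ → IsSigma1 (∃' φ)

/-- Universal (`Π₁`) formulas: a block of universal quantifiers before a bounded formula. -/
inductive IsPi1 : ∀ {n : ℕ}, arith.BoundedFormula α n → Prop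
  | of_delta0 {n : ℕ} {φ : arith.BoundedFormula α n} : IsDelta0 φ → IsPi1 φ
  | all {n : ℕ} {φ : arith.BoundedFormula α (n + 1)} : IsPi1 φ → IsPi1 (∀' φ)

end Formulas

/-- The instance of induction for the formula `φ(x₀, …, x_{n-1}, y)`, where `y` is the last variable:
`∀ x₀ … x_{n-1}, (∀ z, z = 0 → φ(x, z)) → (∀ y, φ(x, y) → ∀ z, z = S y → φ(x, z)) → ∀ y, φ(x, y)`.
In the second occurrence of `φ` in the induction step the last variable is the `z` with index
`n + 1` (and not the `y` with index `n`). -/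
def inductionAxiom {n : ℕ} (φ : arith.BoundedFormula Empty (n + 1)) : arith.Sentence :=
  BoundedFormula.alls (n := n)
    ((∀' (fEq (&(Fin.last n)) tZero ⟹ φ)) ⟹
      (∀' (φ ⟹
        ∀' (fEq (&(Fin.last (n + 1))) (tSucc (&((Fin.last n).castSucc))) ⟹ φ.liftAt 1 n))) ⟹
      ∀' φ)

/-- The axioms of (first-order) Peano arithmetic. -/
inductive IsPeanoAxiom : arith.Sentence → Prop
  | succ_ne_zero : IsPeanoAxiom (∀' ∼(fEq (tSucc (&0)) tZero))
  | succ_inj : IsPeanoAxiom (∀' ∀' (fEq (tSucc (&0)) (tSucc (&1)) ⟹ fEq (&0) (&1)))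
  | add_zero : IsPeanoAxiom (∀' fEq (tAdd (&0) tZero) (&0))
  | add_succ : IsPeanoAxiom (∀' ∀' fEq (tAdd (&0) (tSucc (&1))) (tSucc (tAdd (&0) (&1))))
  | mul_zero : IsPeanoAxiom (∀' fEq (tMul (&0) tZero) tZero)
  | mul_succ : IsPeanoAxiom (∀' ∀' fEq (tMul (&0) (tSucc (&1))) (tAdd (tMul (&0) (&1)) (&0)))
  | le_iff : IsPeanoAxiom (∀' ∀' (fLe (&0) (&1) ⇔ ∃' fEq (tAdd (&0) (&2)) (&1)))
  | induction {n : ℕ} (φ : arith.BoundedFormula Empty (n + 1)) : IsPeanoAxiom (inductionAxiom φ)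

/-- Formal arithmetic (Peano arithmetic). -/
def PA : arith.Theory := {σ | IsPeanoAxiom σ}

/-- The set of all universal sentences that are true in the standard model. -/
def trueUniversal : arith.Theory := {σ | IsPi1 σ ∧ Sentence.Realize ℕ σ}

/-- Two systems of axioms have the same theorems. -/
def SameTheorems (S T : arith.Theory) : Prop := ∀ σ : arith.Sentence, S ⊨ᵇ σ ↔ T ⊨ᵇ σ

/-! ### Binary strings in arithmetic

A binary string `s` is represented by the number `m` such that `m + 1` has the binary expansion
`1s`. This is a bijection between strings and natural numbers; the strings of length less than `k`
correspond to the numbers `m` with `m + 1 < 2 ^ k`. -/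

/-- The number that represents a binary string. -/
def strCode (s : List Bool) : ℕ := s.foldl (fun m b => 2 * m + 1 + b.toNat) 0

section Strings

variable {α : Type} {n : ℕ}

/-- `P` is a power of two: every divisor `d` of `P` is `1` or even. -/
def isPowTwo (P : arith.Term (α ⊕ Fin n)) : arith.BoundedFormula α n :=
  ∀' ∀' (fEq (tMul (&((Fin.last n).castSucc)) (&(Fin.last (n + 1)))) (liftTerm (liftTerm P)) ⟹
    (fEq (&((Fin.last n).castSucc)) (numeral 1) ⊔
      ∃' fEq (&((Fin.last n).castSucc.castSucc))
        (tAdd (&(Fin.last (n + 2))) (&(Fin.last (n + 2))))))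

/-- `|q| ≤ |p| + c`, where `|·|` is the length of the string: `q + 1 < 2 ^ c * P` for every power of
two `P` such that `p + 1 < P`. -/
def lenLeAdd (c : ℕ) (q p : arith.Term (α ⊕ Fin n)) : arith.BoundedFormula α n :=
  ∀' (isPowTwo (&(Fin.last n)) ⟹ fLt (tSucc (liftTerm p)) (&(Fin.last n)) ⟹
    fLt (tSucc (liftTerm q)) (tMul (numeral (2 ^ c)) (&(Fin.last n))))

/-- The string `p` is a prefix of the string `q`: `q + 1 = (p + 1) * P + r` for some power of two `P`
and some `r < P`. -/
def isPrefix (p q : arith.Term (α ⊕ Fin n)) : arith.BoundedFormula α n :=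
  ∃' (isPowTwo (&(Fin.last n)) ⊓ ∃' (fLt (&(Fin.last (n + 1))) (&((Fin.last n).castSucc)) ⊓
    fEq (tSucc (liftTerm (liftTerm q)))
      (tAdd (tMul (tSucc (liftTerm (liftTerm p))) (&((Fin.last n).castSucc)))
        (&(Fin.last (n + 1))))))

end Strings

/-! ### Programming languages and Kolmogorov complexity -/

/-- A programming language, formally represented in arithmetic: an existential formula `U(p, x)`
(“the program `p` terminates with output `x`”; `p` and `x` are strings) such that arithmetic proves
that every program has at most one output. -/
structure IsLanguage (U : arith.Formula (Fin 2)) : Prop where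
  sigma1 : IsSigma1 U
  functional : PA ⊨ᵇ (∀' ∀' ∀' (app₂ U (&0) (&1) ⟹ app₂ U (&0) (&2) ⟹ fEq (&1) (&2)) :
    arith.Sentence)

/-- A programming language is (provably) prefix-free if no program that terminates is a proper prefix
of another one. -/
structure IsPrefixLanguage (U : arith.Formula (Fin 2)) : Prop extends IsLanguage U where
  prefixFree : PA ⊨ᵇ (∀' ∀' ∀' ∀' (app₂ U (&0) (&2) ⟹ app₂ U (&1) (&3) ⟹
    isPrefix (&0) (&1) ⟹ fEq (&0) (&1)) : arith.Sentence)

/-- The complexity with respect to `U` is (provably) at most the complexity with respect to `V` plus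
the constant `c`: for every `V`-program `p` of `x` there is a `U`-program of `x` of length at most
`|p| + c`. -/
def ComplexityLeAdd (U V : arith.Formula (Fin 2)) (c : ℕ) : Prop :=
  PA ⊨ᵇ (∀' ∀' (app₂ V (&0) (&1) ⟹ ∃' (lenLeAdd c (&2) (&0) ⊓ app₂ U (&2) (&1))) :
    arith.Sentence)

/-- `U` is an optimal programming language: it makes the complexity minimal up to an additive
constant. The complexity with respect to `U` is plain Kolmogorov complexity. -/
structure IsOptimalPlain (U : arith.Formula (Fin 2)) : Prop extends IsLanguage U where
  optimal : ∀ V, IsLanguage V → ∃ c, ComplexityLeAdd U V c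

/-- `U` is optimal among the prefix-free programming languages. The complexity with respect to `U` is
prefix Kolmogorov complexity. -/
structure IsOptimalPrefix (U : arith.Formula (Fin 2)) : Prop extends IsPrefixLanguage U where
  optimal : ∀ V, IsPrefixLanguage V → ∃ c, ComplexityLeAdd U V c

/-- In the standard model the program `p` has the output `x`. -/
def Outputs (U : arith.Formula (Fin 2)) (p x : List Bool) : Prop :=
  U.Realize (M := ℕ) ![strCode p, strCode x]

/-- The (true) Kolmogorov complexity of `x` with respect to `U`: the minimal length of a program that
outputs `x`. -/
noncomputable def complexity (U : arith.Formula (Fin 2)) (x : List Bool) : ℕ :=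
  sInf {k | ∃ p : List Bool, p.length = k ∧ Outputs U p x}

/-- The sentence `K(x) < k`: some program of length less than `k` outputs `x`. -/
def sentKLt (U : arith.Formula (Fin 2)) (x : List Bool) (k : ℕ) : arith.Sentence :=
  ∃' (fLt (tSucc (&0)) (numeral (2 ^ k)) ⊓ app₂ U (&0) (numeral (strCode x)))

/-- The sentence `K(x) ≤ k`. -/
def sentKLe (U : arith.Formula (Fin 2)) (x : List Bool) (k : ℕ) : arith.Sentence :=
  sentKLt U x (k + 1)

/-- The sentence `K(x) > k`. -/
def sentKGt (U : arith.Formula (Fin 2)) (x : List Bool) (k : ℕ) : arith.Sentence :=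
  ∼(sentKLe U x k)

/-- The sentence `K(x) = k`. -/
def sentKEq (U : arith.Formula (Fin 2)) (x : List Bool) (k : ℕ) : arith.Sentence :=
  sentKLe U x k ⊓ ∼(sentKLt U x k)

/-- Full information about complexities: for each string `x` the axiom `K(x) = k`, where `k` is the
complexity of `x`. -/
def exactAxioms (U : arith.Formula (Fin 2)) : arith.Theory :=
  {σ | ∃ x : List Bool, σ = sentKEq U x (complexity U x)}

/-- The axioms `K(x) > c x` for all strings `x` of positive complexity. As `K(x)` is an integer,
`K(x) > c x` is written as `K(x) > ⌊c x⌋`. -/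
def lowerBoundAxioms (U : arith.Formula (Fin 2)) (c : List Bool → ℝ) : arith.Theory :=
  {σ | ∃ x : List Bool, 0 < complexity U x ∧ σ = sentKGt U x ⌊c x⌋₊}

end KolmogorovArithmetic

open KolmogorovArithmetic

/-! By completeness it suffices to show that a model `M` of PA satisfies one set of axioms exactly
when it satisfies the other.

From universal truths to complexities: a true bound K(x) > k is, up to logical equivalence, a true
universal sentence, and a true bound K(x) ≤ k is existential, so it holds in every model
(`IsSigma1.realize_natCast_of_realize`).

From complexities to universal truths (`realize_of_lowerBounds`): suppose that a true universal σ
fails in `M`. Bounded formulas are absolute, so the least bound `t` of a counterexample is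
nonstandard and exceeds the running time of every program that really terminates. Thus "terminates
within `t`" decides the halting problem for standard programs. Let `V` be the language that, on the
program 0^(k-1)1, searches for `t` and outputs the least string with no `U`-program of code at most
2^(4k) that terminates within `t`. In ℕ the search never ends, but PA proves that `V` is a
prefix-free language, so optimality yields a constant m with K_U ≤ K_V + m in `M`. Take k = m + 1.
The output s is a standard string by counting, and its true complexity is at least 4m + 4, so the
axiom for s claims K(s) > ⌊c⌋ with ⌊c⌋ ≥ 2m + 2. But in `M` the string s has a `V`-program of length
m + 1, hence a `U`-program of length at most 2m + 1: a contradiction.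

Exact values are covered by the choice c = K - 1/2. As `V` is prefix-free, the same argument serves
plain and prefix complexity. -/

namespace KolmogorovArithmetic

open FirstOrder FirstOrder.Language

/-! ### Semantics of the arithmetical symbols -/

section Semantics

variable {N : Type} [arith.Structure N] {α : Type} {n : ℕ}

variable (N) in
/-- The interpretation of `0`. -/
def opZero : N := Structure.funMap (L := arith) ArithFunc.zero ![]

/-- The interpretation of `S`. -/
def opSucc (a : N) : N := Structure.funMap (L := arith) ArithFunc.succ ![a]

/-- The interpretation of `+`. -/
def opAdd (a b : N) : N := Structure.funMap (L := arith) ArithFunc.add ![a, b]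

/-- The interpretation of `·`. -/
def opMul (a b : N) : N := Structure.funMap (L := arith) ArithFunc.mul ![a, b]

/-- The interpretation of `≤`. -/
def opLe (a b : N) : Prop := Structure.RelMap (L := arith) ArithRel.le ![a, b]

/-- The interpretation of the numerals. -/
def opNum : ℕ → N
  | 0 => opZero N
  | m + 1 => opSucc (opNum m)

@[simp]
theorem realize_tZero (v : α → N) : (tZero : arith.Term α).realize v = opZero N :=
  congrArg (Structure.funMap (L := arith) (M := N) ArithFunc.zero) (funext finZeroElim)

@[simp]
theorem realize_tSucc (t : arith.Term α) (v : α → N) :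
    (tSucc t).realize v = opSucc (t.realize v) :=
  Term.realize_functions_apply₁

@[simp]
theorem realize_tAdd (s t : arith.Term α) (v : α → N) :
    (tAdd s t).realize v = opAdd (s.realize v) (t.realize v) :=
  Term.realize_functions_apply₂

@[simp]
theorem realize_tMul (s t : arith.Term α) (v : α → N) :
    (tMul s t).realize v = opMul (s.realize v) (t.realize v) :=
  Term.realize_functions_apply₂

@[simp]
theorem realize_numeral (m : ℕ) (v : α → N) :
    (numeral m : arith.Term α).realize v = opNum m := by
  induction m with
  | zero => exact realize_tZero v
  | succ m ih => rw [numeral, realize_tSucc, ih, opNum]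

@[simp]
theorem realize_fLe (s t : arith.Term (α ⊕ Fin n)) (v : α → N) (xs : Fin n → N) :
    (fLe s t).Realize v xs ↔
      opLe (s.realize (Sum.elim v xs)) (t.realize (Sum.elim v xs)) :=
  BoundedFormula.realize_rel₂

@[simp]
theorem realize_fLt (s t : arith.Term (α ⊕ Fin n)) (v : α → N) (xs : Fin n → N) :
    (fLt s t).Realize v xs ↔
      opLe (opSucc (s.realize (Sum.elim v xs))) (t.realize (Sum.elim v xs)) := by
  rw [fLt, realize_fLe, realize_tSucc]

@[simp]
theorem realize_fEq (s t : arith.Term (α ⊕ Fin n)) (v : α → N) (xs : Fin n → N) :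
    (fEq s t).Realize v xs ↔ s.realize (Sum.elim v xs) = t.realize (Sum.elim v xs) :=
  Iff.rfl

@[simp]
theorem realize_app₂ (U : arith.Formula (Fin 2)) (s t : arith.Term (α ⊕ Fin n)) (v : α → N)
    (xs : Fin n → N) :
    (app₂ U s t).Realize v xs ↔
      U.Realize ![s.realize (Sum.elim v xs), t.realize (Sum.elim v xs)] := by
  rw [app₂, BoundedFormula.realize_relabel, BoundedFormula.realize_subst, Formula.Realize,
    iff_iff_eq]
  congr 1
  · funext i
    fin_cases i <;> rfl
  · exact funext finZeroElim

@[simp]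
theorem realize_liftTerm (t : arith.Term (α ⊕ Fin n)) (v : α → N) (xs : Fin n → N) (a : N) :
    (liftTerm t).realize (Sum.elim v (Fin.snoc xs a : Fin (n + 1) → N)) =
      t.realize (Sum.elim v xs) := by
  rw [liftTerm, Term.realize_relabel]
  congr 1
  funext i
  rcases i with i | i
  · rfl
  · exact Fin.snoc_castSucc (α := fun _ => N) a xs i

/-- Every divisor of `P` is `1` or even. -/
def IsPow (P : N) : Prop :=
  ∀ d e : N, opMul d e = P → d = opNum 1 ∨ ∃ h, d = opAdd h h

@[simp]
theorem realize_isPowTwo (P : arith.Term (α ⊕ Fin n)) (v : α → N) (xs : Fin n → N) :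
    (isPowTwo P).Realize v xs ↔ IsPow (P.realize (Sum.elim v xs)) := by
  simp [isPowTwo, IsPow, Fin.snoc_castSucc, Fin.snoc_last]

/-- Lifting moves the variable with index n to n + 1, so the lifted formula ignores y and speaks of
z. This gives the meaning of the second copy of φ in the induction step and in `exists_least`. -/
theorem realize_liftAt_snoc (φ : arith.BoundedFormula α (n + 1)) (v : α → N) (xs : Fin n → N)
    (y z : N) :
    (φ.liftAt 1 n).Realize v
      (Fin.snoc (Fin.snoc xs y : Fin (n + 1) → N) z : Fin (n + 2) → N) ↔
    φ.Realize v (Fin.snoc xs z : Fin (n + 1) → N) := by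
  rw [BoundedFormula.realize_liftAt_one (Nat.le_succ n), iff_iff_eq]
  congr 1
  funext i
  refine Fin.lastCases ?_ (fun i => ?_) i
  · simp only [Function.comp_apply, Fin.val_last, lt_irrefl, if_false, Fin.succ_last,
      Fin.snoc_last]
  · simp

/-- The instance of induction for `φ` and its parameters. -/
theorem realize_inductionAxiom (φ : arith.BoundedFormula Empty (n + 1)) :
    N ⊨ inductionAxiom φ ↔ ∀ xs : Fin n → N,
      φ.Realize default (Fin.snoc xs (opZero N) : Fin (n + 1) → N) →
      (∀ y : N, φ.Realize default (Fin.snoc xs y : Fin (n + 1) → N) →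
        φ.Realize default (Fin.snoc xs (opSucc y) : Fin (n + 1) → N)) →
      ∀ y : N, φ.Realize default (Fin.snoc xs y : Fin (n + 1) → N) := by
  refine BoundedFormula.realize_alls.trans ?_
  refine forall_congr' fun xs => ?_
  simp only [BoundedFormula.realize_imp, BoundedFormula.realize_all, realize_fEq, realize_tSucc,
    realize_tZero, realize_liftAt_snoc, Term.realize_var, Sum.elim_inr, Fin.snoc_last, Fin.snoc_castSucc,
    Function.comp_apply, forall_eq]

end Semantics

/-! ### Models of Peano arithmetic are discretely ordered semirings -/

section Models

variable {M : Type} [arith.Structure M] [hM : M ⊨ PA]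

theorem realize_of_isPeanoAxiom {σ : arith.Sentence} (h : IsPeanoAxiom σ) : M ⊨ σ :=
  Theory.realize_sentence_of_mem PA (show σ ∈ PA from h)

/-- The form in which induction is used: a semantic predicate `p`, together with a formula that
defines it from the parameters `xs`. -/
theorem induction_of_formula {n : ℕ} (φ : arith.BoundedFormula Empty (n + 1)) (xs : Fin n → M)
    (p : M → Prop) (hp : ∀ y, φ.Realize default (Fin.snoc xs y : Fin (n + 1) → M) ↔ p y)
    (h0 : p (opZero M)) (hs : ∀ y, p y → p (opSucc y)) (y : M) : p y := by
  have := (realize_inductionAxiom (N := M) φ).1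
    (realize_of_isPeanoAxiom (IsPeanoAxiom.induction φ)) xs
  simp only [hp] at this
  exact this h0 hs y

theorem opSucc_ne_zero (a : M) : opSucc a ≠ opZero M := by
  have := realize_of_isPeanoAxiom (M := M) .succ_ne_zero
  simp [Sentence.Realize, Formula.Realize, Fin.snoc] at this
  exact this a

theorem opSucc_inj {a b : M} (h : opSucc a = opSucc b) : a = b := by
  have := realize_of_isPeanoAxiom (M := M) .succ_inj
  simp [Sentence.Realize, Formula.Realize, Fin.snoc] at this
  exact this a b h

theorem opAdd_zero (a : M) : opAdd a (opZero M) = a := by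
  have := realize_of_isPeanoAxiom (M := M) .add_zero
  simp [Sentence.Realize, Formula.Realize, Fin.snoc] at this
  exact this a

theorem opAdd_succ (a b : M) : opAdd a (opSucc b) = opSucc (opAdd a b) := by
  have := realize_of_isPeanoAxiom (M := M) .add_succ
  simp [Sentence.Realize, Formula.Realize, Fin.snoc] at this
  exact this a b

theorem opMul_zero (a : M) : opMul a (opZero M) = opZero M := by
  have := realize_of_isPeanoAxiom (M := M) .mul_zero
  simp [Sentence.Realize, Formula.Realize, Fin.snoc] at this
  exact this a

theorem opMul_succ (a b : M) : opMul a (opSucc b) = opAdd (opMul a b) a := by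
  have := realize_of_isPeanoAxiom (M := M) .mul_succ
  simp [Sentence.Realize, Formula.Realize, Fin.snoc] at this
  exact this a b

theorem opLe_iff (a b : M) : opLe a b ↔ ∃ c, opAdd a c = b := by
  have := realize_of_isPeanoAxiom (M := M) .le_iff
  simp [Sentence.Realize, Formula.Realize, Fin.snoc] at this
  exact this a b

/-! ### Algebraic laws, by induction inside the model -/

theorem opZero_add (a : M) : opAdd (opZero M) a = a := by
  refine induction_of_formula (n := 0) (fEq (tAdd tZero (&0)) (&0)) ![]
    (fun a => opAdd (opZero M) a = a) (by simp) (opAdd_zero _) (fun y h => ?_) a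
  rw [opAdd_succ, h]

theorem opSucc_add (a b : M) : opAdd (opSucc a) b = opSucc (opAdd a b) := by
  refine induction_of_formula (n := 1) (fEq (tAdd (tSucc (&0)) (&1)) (tSucc (tAdd (&0) (&1)))) ![a]
    (fun b => opAdd (opSucc a) b = opSucc (opAdd a b)) (by simp)
    (by rw [opAdd_zero, opAdd_zero]) (fun y h => ?_) b
  rw [opAdd_succ, h, opAdd_succ]

theorem opAdd_comm (a b : M) : opAdd a b = opAdd b a := by
  refine induction_of_formula (n := 1) (fEq (tAdd (&0) (&1)) (tAdd (&1) (&0))) ![a]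
    (fun b => opAdd a b = opAdd b a) (by simp)
    (by rw [opAdd_zero, opZero_add]) (fun y h => ?_) b
  rw [opAdd_succ, h, opSucc_add]

theorem opAdd_assoc (a b c : M) : opAdd (opAdd a b) c = opAdd a (opAdd b c) := by
  refine induction_of_formula (n := 2)
    (fEq (tAdd (tAdd (&0) (&1)) (&2)) (tAdd (&0) (tAdd (&1) (&2)))) ![a, b]
    (fun c => opAdd (opAdd a b) c = opAdd a (opAdd b c)) (by simp)
    (by rw [opAdd_zero, opAdd_zero]) (fun y h => ?_) c
  simp only [opAdd_succ, h]

theorem opZero_mul (a : M) : opMul (opZero M) a = opZero M := by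
  refine induction_of_formula (n := 0) (fEq (tMul tZero (&0)) tZero) ![]
    (fun a => opMul (opZero M) a = opZero M) (by simp) (opMul_zero _)
    (fun y h => ?_) a
  rw [opMul_succ, h, opAdd_zero]

theorem opSucc_mul (a b : M) : opMul (opSucc a) b = opAdd (opMul a b) b := by
  refine induction_of_formula (n := 1)
    (fEq (tMul (tSucc (&0)) (&1)) (tAdd (tMul (&0) (&1)) (&1))) ![a]
    (fun b => opMul (opSucc a) b = opAdd (opMul a b) b) (by simp)
    (by rw [opMul_zero, opMul_zero, opAdd_zero]) (fun y h => ?_) b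
  rw [opMul_succ, h, opMul_succ, opAdd_succ, opAdd_succ, opAdd_assoc, opAdd_assoc, opAdd_comm y a]

theorem opMul_comm (a b : M) : opMul a b = opMul b a := by
  refine induction_of_formula (n := 1) (fEq (tMul (&0) (&1)) (tMul (&1) (&0))) ![a]
    (fun b => opMul a b = opMul b a) (by simp)
    (by rw [opMul_zero, opZero_mul]) (fun y h => ?_) b
  rw [opMul_succ, h, opSucc_mul]

theorem opMul_add (a b c : M) : opMul a (opAdd b c) = opAdd (opMul a b) (opMul a c) := by
  refine induction_of_formula (n := 2)
    (fEq (tMul (&0) (tAdd (&1) (&2))) (tAdd (tMul (&0) (&1)) (tMul (&0) (&2)))) ![a, b]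
    (fun c => opMul a (opAdd b c) = opAdd (opMul a b) (opMul a c)) (by simp)
    (by rw [opMul_zero, opAdd_zero, opAdd_zero]) (fun y h => ?_) c
  rw [opAdd_succ, opMul_succ, opMul_succ, h, opAdd_assoc]

theorem opMul_assoc (a b c : M) : opMul (opMul a b) c = opMul a (opMul b c) := by
  refine induction_of_formula (n := 2)
    (fEq (tMul (tMul (&0) (&1)) (&2)) (tMul (&0) (tMul (&1) (&2)))) ![a, b]
    (fun c => opMul (opMul a b) c = opMul a (opMul b c)) (by simp)
    (by rw [opMul_zero, opMul_zero, opMul_zero]) (fun y h => ?_) c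
  rw [opMul_succ, opMul_succ, opMul_add, h]

theorem opAdd_right_cancel (a b c : M) : opAdd a c = opAdd b c → a = b := by
  refine induction_of_formula (n := 2)
    (fEq (tAdd (&0) (&2)) (tAdd (&1) (&2)) ⟹ fEq (&0) (&1)) ![a, b]
    (fun c => opAdd a c = opAdd b c → a = b) (by simp)
    (by rw [opAdd_zero, opAdd_zero]; exact id) (fun y h e => ?_) c
  rw [opAdd_succ, opAdd_succ] at e
  exact h (opSucc_inj e)

theorem eq_opZero_or_opSucc (a : M) : a = opZero M ∨ ∃ b, a = opSucc b := by
  refine induction_of_formula (n := 0)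
    (fEq (&0) tZero ⊔ ∃' fEq (&0) (tSucc (&1))) ![]
    (fun a => a = opZero M ∨ ∃ b, a = opSucc b) (by simp)
    (Or.inl rfl) (fun y _ => Or.inr ⟨y, rfl⟩) a

theorem opLe_total (a b : M) : opLe a b ∨ opLe b a := by
  refine induction_of_formula (n := 1) (fLe (&0) (&1) ⊔ fLe (&1) (&0)) ![a]
    (fun b => opLe a b ∨ opLe b a) (by simp)
    (Or.inr ((opLe_iff _ _).2 ⟨a, opZero_add a⟩)) (fun y h => ?_) b
  simp only [opLe_iff] at h ⊢
  rcases h with ⟨c, rfl⟩ | ⟨c, rfl⟩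
  · exact Or.inl ⟨opSucc c, opAdd_succ a c⟩
  · rcases eq_opZero_or_opSucc c with rfl | ⟨d, rfl⟩
    · exact Or.inl ⟨opSucc (opZero M), by rw [opAdd_zero, opAdd_succ, opAdd_zero]⟩
    · exact Or.inr ⟨d, by rw [opSucc_add, opAdd_succ]⟩

theorem opLe_antisymm {a b : M} (h : opLe a b) (h' : opLe b a) : a = b := by
  simp only [opLe_iff] at h h'
  obtain ⟨c, rfl⟩ := h
  obtain ⟨d, hd⟩ := h'
  rw [opAdd_assoc] at hd
  have hcd : opAdd c d = opZero M := by
    refine opAdd_right_cancel _ _ a ?_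
    rw [opAdd_comm, hd, opZero_add]
  rcases eq_opZero_or_opSucc c with rfl | ⟨e, rfl⟩
  · rw [opAdd_zero]
  · rw [opSucc_add] at hcd
    exact absurd hcd (opSucc_ne_zero _)

/-! ### The ordered semiring structure of a model -/

instance : CommSemiring M where
  add := opAdd
  zero := opZero M
  mul := opMul
  one := opSucc (opZero M)
  add_assoc := opAdd_assoc
  zero_add := opZero_add
  add_zero := opAdd_zero
  add_comm := opAdd_comm
  mul_assoc := opMul_assoc
  mul_comm := opMul_comm
  left_distrib := opMul_add
  right_distrib a b c := by
    change opMul (opAdd a b) c = opAdd (opMul a c) (opMul b c)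
    rw [opMul_comm, opMul_add, opMul_comm c a, opMul_comm c b]
  zero_mul := opZero_mul
  mul_zero := opMul_zero
  one_mul a := by
    change opMul (opSucc (opZero M)) a = a
    rw [opSucc_mul, opZero_mul, opZero_add]
  mul_one a := by
    change opMul a (opSucc (opZero M)) = a
    rw [opMul_succ, opMul_zero, opZero_add]
  nsmul := @nsmulRec M ⟨opZero M⟩ ⟨opAdd⟩

noncomputable instance : LinearOrder M where
  le := opLe
  le_refl a := (opLe_iff a a).2 ⟨_, opAdd_zero a⟩
  le_trans a b c h h' := by
    rw [opLe_iff] at *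
    obtain ⟨d, rfl⟩ := h
    obtain ⟨e, rfl⟩ := h'
    exact ⟨_, (opAdd_assoc a d e).symm⟩
  le_antisymm _ _ := opLe_antisymm
  le_total := opLe_total
  toDecidableLE := Classical.decRel _

theorem opZero_eq : opZero M = 0 := rfl

theorem opSucc_eq (a : M) : opSucc a = a + 1 := by
  change opSucc a = opAdd a (opSucc (opZero M))
  rw [opAdd_succ, opAdd_zero]

theorem opAdd_eq (a b : M) : opAdd a b = a + b := rfl

theorem opMul_eq (a b : M) : opMul a b = a * b := rfl

theorem opLe_eq (a b : M) : opLe a b ↔ a ≤ b := Iff.rfl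

theorem opNum_eq (m : ℕ) : (opNum m : M) = m := by
  induction m with
  | zero => rw [Nat.cast_zero, opNum, opZero_eq]
  | succ m ih => rw [Nat.cast_succ, opNum, opSucc_eq, ih]

instance : CanonicallyOrderedAdd M where
  exists_add_of_le {a b} h := by
    obtain ⟨c, hc⟩ := (opLe_iff a b).1 h
    exact ⟨c, hc.symm⟩
  le_add_self a b := (opLe_iff _ _).2 ⟨b, opAdd_comm a b⟩
  le_self_add a b := (opLe_iff _ _).2 ⟨b, rfl⟩

instance : IsCancelAdd M where
  add_right_cancel a b c h := opAdd_right_cancel b c a h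
  add_left_cancel a b c h :=
    opAdd_right_cancel b c a ((opAdd_comm b a).trans (h.trans (opAdd_comm a c)))

instance : Nontrivial M := ⟨⟨0, 1, fun h => opSucc_ne_zero (opZero M) h.symm⟩⟩

instance : IsOrderedCancelAddMonoid M where
  add_le_add_left a b h c := by
    obtain ⟨d, rfl⟩ := exists_add_of_le h
    exact le_iff_exists_add.2 ⟨d, by ring⟩
  le_of_add_le_add_left a b c h := by
    obtain ⟨d, hd⟩ := exists_add_of_le h
    exact le_iff_exists_add.2 ⟨d, add_left_cancel (hd.trans (add_assoc _ _ _))⟩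

theorem eq_zero_or_eq_add_one (a : M) : a = 0 ∨ ∃ b, a = b + 1 := by
  simpa only [opSucc_eq, opZero_eq] using eq_opZero_or_opSucc a

theorem add_one_le_iff_lt {a b : M} : a + 1 ≤ b ↔ a < b := by
  refine ⟨fun h => lt_of_lt_of_le (lt_add_of_pos_right a (pos_iff_ne_zero.2 one_ne_zero)) h,
    fun h => ?_⟩
  obtain ⟨c, rfl⟩ := exists_add_of_le h.le
  rcases eq_zero_or_eq_add_one c with rfl | ⟨d, rfl⟩
  · simp at h
  · exact le_iff_exists_add.2 ⟨d, by ring⟩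

theorem mul_lt_mul_left_of_pos {a b c : M} (ha : 0 < a) (h : b < c) : a * b < a * c := by
  obtain ⟨d, rfl⟩ := exists_add_of_le (add_one_le_iff_lt.2 ha)
  obtain ⟨e, rfl⟩ := exists_add_of_le (add_one_le_iff_lt.2 h)
  exact add_one_le_iff_lt.1 (le_iff_exists_add.2 ⟨d + e + d * e, by ring⟩)

instance : IsStrictOrderedRing M where
  zero_le_one := zero_le
  mul_lt_mul_of_pos_left _ ha _ _ h := mul_lt_mul_left_of_pos ha h
  mul_lt_mul_of_pos_right a ha b c h := by
    simpa only [mul_comm _ a] using mul_lt_mul_left_of_pos ha h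

/-- The least number principle: if there were no least element, induction on y would show that no z
≤ y satisfies `p`. -/
theorem exists_least {n : ℕ} (φ : arith.BoundedFormula Empty (n + 1)) (xs : Fin n → M)
    (p : M → Prop) (hp : ∀ y, φ.Realize default (Fin.snoc xs y : Fin (n + 1) → M) ↔ p y)
    {a : M} (ha : p a) : ∃ b, p b ∧ ∀ c, p c → b ≤ c := by
  by_contra! hcon
  refine induction_of_formula
    (∀' (fLe (&(Fin.last (n + 1))) (&((Fin.last n).castSucc)) ⟹ ∼(φ.liftAt 1 n))) xs
    (fun y => ∀ z, z ≤ y → ¬ p z) (fun y => ?_) ?_ (fun y h z hz hpz => ?_) a a le_rfl ha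
  · simp only [BoundedFormula.realize_all, BoundedFormula.realize_imp, realize_fLe,
      BoundedFormula.realize_not, realize_liftAt_snoc, hp, Term.realize_var, Sum.elim_inr,
      Fin.snoc_last, Fin.snoc_castSucc, Function.comp_apply, opLe_eq]
  · intro z hz hpz
    obtain ⟨c, -, hc⟩ := hcon z hpz
    exact absurd (lt_of_lt_of_le hc hz) not_lt_zero
  · obtain ⟨c, hpc, hc⟩ := hcon z hpz
    refine h c ?_ hpc
    rw [opSucc_eq] at hz
    exact le_of_add_le_add_right ((add_one_le_iff_lt.2 hc).trans hz)

/-- The standard numbers form an initial segment of every model. Absoluteness of bounded formulas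
and the counting argument both rest on this. -/
theorem exists_nat_of_le {a : M} {n : ℕ} (h : a ≤ n) : ∃ k ≤ n, a = k := by
  induction n with
  | zero => exact ⟨0, le_rfl, le_antisymm h (by simp)⟩
  | succ n ih =>
    rcases h.lt_or_eq with h | h
    · rw [← add_one_le_iff_lt, Nat.cast_succ] at h
      obtain ⟨k, hk, rfl⟩ := ih (le_of_add_le_add_right h)
      exact ⟨k, hk.trans n.le_succ, rfl⟩
    · exact ⟨n + 1, le_rfl, h⟩

/-! ### Powers of two in models of arithmetic -/

theorem isPow_iff {P : M} : IsPow P ↔ ∀ d e : M, d * e = P → d = 1 ∨ ∃ h, d = h + h := by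
  simp only [IsPow, opMul_eq, opAdd_eq, opNum_eq, Nat.cast_one]

theorem even_or_odd (a : M) : (∃ k, a = k + k) ∨ ∃ k, a = k + k + 1 := by
  refine induction_of_formula (n := 0)
    ((∃' fEq (&0) (tAdd (&1) (&1))) ⊔ ∃' fEq (&0) (tSucc (tAdd (&1) (&1)))) ![]
    (fun a => (∃ k, a = k + k) ∨ ∃ k, a = k + k + 1) (fun a => ?_) ?_ ?_ a
  · simp [opSucc_eq, opAdd_eq]
  · exact Or.inl ⟨0, (add_zero 0).symm⟩
  · rintro y (⟨k, rfl⟩ | ⟨k, rfl⟩) <;> rw [opSucc_eq]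
    · exact Or.inr ⟨k, rfl⟩
    · exact Or.inl ⟨k + 1, by ring⟩

theorem add_self_ne_add_self_add_one (k l : M) : k + k ≠ l + l + 1 := by
  intro h
  rcases le_or_gt k l with hkl | hkl
  · exact (lt_of_le_of_lt (add_le_add hkl hkl) (lt_add_one (l + l))).ne h
  · have := add_le_add (add_one_le_iff_lt.2 hkl) (add_one_le_iff_lt.2 hkl)
    rw [h, show l + 1 + (l + 1) = l + l + 1 + 1 by ring] at this
    exact absurd this (not_le.2 (lt_add_one _))

theorem add_self_injective {k l : M} (h : k + k = l + l) : k = l := by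
  rcases lt_trichotomy k l with hkl | hkl | hkl
  · exact absurd h (add_lt_add hkl hkl).ne
  · exact hkl
  · exact absurd h (add_lt_add hkl hkl).ne'

theorem isPow_one : IsPow (1 : M) :=
  isPow_iff.2 fun d e h => Or.inl (by
    have hd : d ≠ 0 := by rintro rfl; simp at h
    have he : e ≠ 0 := by rintro rfl; simp at h
    have hd' := add_one_le_iff_lt.2 (pos_iff_ne_zero.2 hd)
    have he' := add_one_le_iff_lt.2 (pos_iff_ne_zero.2 he)
    rw [zero_add] at hd' he'
    exact le_antisymm (h ▸ le_mul_of_one_le_right' he') hd')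

theorem IsPow.eq_one_or_even {P : M} (h : IsPow P) : P = 1 ∨ ∃ k, P = k + k :=
  isPow_iff.1 h P 1 (mul_one P)

theorem IsPow.ne_zero {P : M} (h : IsPow P) : P ≠ 0 := by
  rintro rfl
  -- The odd number 3 divides 0.
  rcases isPow_iff.1 h (1 + 1 + 1) 0 (mul_zero _) with h | ⟨k, h⟩
  · exact absurd h (by simp [add_assoc])
  · exact add_self_ne_add_self_add_one _ _ h.symm

/-- An odd divisor d of 2P has an even cofactor, so d already divides P. -/
theorem IsPow.double {P : M} (h : IsPow P) : IsPow (P + P) := by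
  refine isPow_iff.2 fun d e hde => ?_
  rcases even_or_odd d with hd | ⟨k, rfl⟩
  · exact Or.inr hd
  · rcases even_or_odd e with ⟨l, rfl⟩ | ⟨l, rfl⟩
    · exact isPow_iff.1 h _ l (add_self_injective (by rw [← mul_add, hde]))
    -- (2k + 1)(2l + 1) = 2(2kl + k + l) + 1 cannot be even.
    · refine absurd (hde.symm.trans ?_)
        (add_self_ne_add_self_add_one P (k * l + k * l + k + l))
      ring

theorem IsPow.half {P : M} (h : IsPow (P + P)) : IsPow P :=
  isPow_iff.2 fun d e hde => isPow_iff.1 h d (e + e) (by rw [mul_add, hde])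

theorem isPow_two_pow (k : ℕ) : IsPow ((2 ^ k : ℕ) : M) := by
  induction k with
  | zero => simpa using isPow_one
  | succ k ih =>
    rw [pow_succ, mul_two, Nat.cast_add]
    exact ih.double

/-- Exponents are not available in the model, so the proof is by descent: a least bad factor R is
not 1, and its half is again bad. -/
theorem IsPow.mul {P R : M} (hP : IsPow P) (hR : IsPow R) : IsPow (P * R) := by
  by_contra hcon
  obtain ⟨b, ⟨hb, hPb⟩, hmin⟩ := exists_least (n := 1)
    (isPowTwo (&1) ⊓ ∼(isPowTwo (tMul (&0) (&1)))) ![P]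
    (fun R => IsPow R ∧ ¬ IsPow (P * R)) (fun y => by simp [opMul_eq]) ⟨hR, hcon⟩
  rcases hb.eq_one_or_even with rfl | ⟨k, rfl⟩
  · exact hPb (by rwa [mul_one])
  · have := hmin k ⟨hb.half, fun h => hPb (by rw [mul_add]; exact h.double)⟩
    exact hb.ne_zero (by simpa using this)

/-- Descent again: if P lies strictly between Q and 2Q, then both are even and their halves have the
same property. -/
theorem IsPow.not_between {P Q : M} (hP : IsPow P) (hQ : IsPow Q) (h : Q < P) : Q + Q ≤ P := by
  by_contra! hcon
  obtain ⟨b, ⟨hb, P, hP, hlt, hgt⟩, hmin⟩ := exists_least (n := 0)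
    (isPowTwo (&0) ⊓ ∃' (isPowTwo (&1) ⊓ (fLt (&0) (&1) ⊓ fLt (&1) (tAdd (&0) (&0))))) ![]
    (fun Q : M => IsPow Q ∧ ∃ P, IsPow P ∧ Q < P ∧ P < Q + Q)
    (fun y => by simp [opAdd_eq, opSucc_eq, opLe_eq, add_one_le_iff_lt])
    ⟨hQ, P, hP, h, hcon⟩
  have hb1 := add_one_le_iff_lt.2 (pos_iff_ne_zero.2 hb.ne_zero)
  rw [zero_add] at hb1
  rcases hP.eq_one_or_even with rfl | ⟨k, rfl⟩
  · exact absurd hlt (not_lt.2 hb1)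
  rcases hb.eq_one_or_even with rfl | ⟨l, rfl⟩
  · exact absurd (add_one_le_iff_lt.2 hlt) (not_le.2 hgt)
  · have := hmin l ⟨hb.half, k, hP.half, ?_, ?_⟩
    · exact hb.ne_zero (by simpa using this)
    · by_contra! hkl
      exact absurd hlt (not_lt.2 (add_le_add hkl hkl))
    · by_contra! hkl
      exact absurd hgt (not_lt.2 (add_le_add hkl hkl))

/-- The code 2^k with k ≥ 1 is the string 0^(k-1)1, and no such string is a proper prefix of
another. In arithmetical terms, R ≥ 2 would force PR < Q < 2PR, with no room for a power of two. The
condition P ≥ 2 excludes the code 1, the string 0, which is a prefix of 01. -/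
theorem IsPow.eq_of_prefix {P Q R r : M} (hP : IsPow P) (hQ : IsPow Q) (hR : IsPow R)
    (hP2 : 2 ≤ P) (hr : r < R) (h : Q + 1 = (P + 1) * R + r) : P = Q := by
  rcases hR.eq_one_or_even with rfl | ⟨k, rfl⟩
  · have : r = 0 := by
      by_contra h0
      have := add_one_le_iff_lt.2 (pos_iff_ne_zero.2 h0)
      rw [zero_add] at this
      exact absurd hr (not_lt.2 this)
    rw [this, mul_one, add_zero] at h
    exact (add_right_cancel h).symm
  · exfalso
    set R := k + k with hRk
    have hk : 1 ≤ k := by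
      rw [← zero_add (1 : M), add_one_le_iff_lt, pos_iff_ne_zero]
      rintro rfl
      exact hR.ne_zero (by simp [hRk])
    have h1 : P * R < Q := by
      rw [← add_one_le_iff_lt]
      refine le_of_add_le_add_right (a := 1) ?_
      rw [h]
      calc P * R + 1 + 1 = P * R + (1 + 1) := by ring
        _ ≤ P * R + R := by gcongr; exact add_le_add hk hk
        _ ≤ (P + 1) * R + r := le_iff_exists_add.2 ⟨r, by ring⟩
    have h2 := hQ.not_between (hP.mul hR) h1
    have h3 : Q + 1 + 1 ≤ P * R + P * R := by
      calc Q + 1 + 1 = (P + 1) * R + (r + 1) := by rw [h]; ring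
        _ ≤ (P + 1) * R + R := by gcongr; exact add_one_le_iff_lt.2 hr
        _ = P * R + 2 * R := by ring
        _ ≤ P * R + P * R := by gcongr
    have := h3.trans h2
    rw [add_one_le_iff_lt] at this
    exact absurd (this.trans_le' le_self_add) (lt_irrefl _)

end Models

/-! ### The standard model -/

theorem nat_opZero : opZero ℕ = 0 := rfl

theorem nat_opSucc (a : ℕ) : opSucc a = a + 1 := rfl

theorem nat_opAdd (a b : ℕ) : opAdd a b = a + b := rfl

theorem nat_opMul (a b : ℕ) : opMul a b = a * b := rfl

theorem nat_opLe (a b : ℕ) : opLe a b ↔ a ≤ b := Iff.rfl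

theorem nat_opNum (m : ℕ) : (opNum m : ℕ) = m := by
  induction m with
  | zero => rfl
  | succ m ih => rw [opNum, ih, nat_opSucc]

/-- Deliberately not an instance: it would give ℕ a second semiring structure and a second order. -/
theorem nat_models_PA : ℕ ⊨ PA := by
  refine ⟨fun σ hσ => ?_⟩
  cases (show IsPeanoAxiom σ from hσ) with
  | induction φ =>
    exact (realize_inductionAxiom φ).2 fun xs h0 hs y => Nat.rec h0 hs y
  | le_iff =>
    simp [Sentence.Realize, Formula.Realize, Fin.snoc, nat_opAdd, nat_opLe, le_iff_exists_add,
      eq_comm]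
  | _ =>
    simp [Sentence.Realize, Formula.Realize, Fin.snoc, nat_opAdd, nat_opSucc, nat_opMul,
      nat_opZero, Nat.mul_succ, Nat.add_assoc]

/-! ### Bounded, existential and universal formulas -/

section Delta0

variable {α β : Type} {n m : ℕ}

theorem IsDelta0.not {φ : arith.BoundedFormula α n} (h : IsDelta0 φ) : IsDelta0 (∼φ) :=
  h.imp .falsum

theorem IsDelta0.inf {φ ψ : arith.BoundedFormula α n} (h : IsDelta0 φ) (h' : IsDelta0 ψ) :
    IsDelta0 (φ ⊓ ψ) :=
  (h.imp h'.not).not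

theorem IsDelta0.sup {φ ψ : arith.BoundedFormula α n} (h : IsDelta0 φ) (h' : IsDelta0 ψ) :
    IsDelta0 (φ ⊔ ψ) :=
  h.not.imp h'

theorem isDelta0_fLe (s t : arith.Term (α ⊕ Fin n)) : IsDelta0 (fLe s t) := .rel _ _

theorem isDelta0_fEq (s t : arith.Term (α ⊕ Fin n)) : IsDelta0 (fEq s t) := .equal _ _

/-- The substitution `f` under a quantifier. -/
def liftSubst (f : α ⊕ Fin n → arith.Term (β ⊕ Fin m)) :
    α ⊕ Fin (n + 1) → arith.Term (β ⊕ Fin (m + 1)) :=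
  Sum.elim (fun a => liftTerm (f (Sum.inl a)))
    (Fin.snoc (α := fun _ => arith.Term (β ⊕ Fin (m + 1)))
      (fun i => liftTerm (f (Sum.inr i))) (&(Fin.last m)))

theorem realize_liftSubst_inl {N : Type} [arith.Structure N]
    (f : α ⊕ Fin n → arith.Term (β ⊕ Fin m)) (v : β → N) (xs : Fin m → N) (y : N) :
    (fun a => (liftSubst f (Sum.inl a)).realize
      (Sum.elim v (Fin.snoc xs y : Fin (m + 1) → N))) =
    fun a => (f (Sum.inl a)).realize (Sum.elim v xs) := by
  funext a
  simp [liftSubst]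

theorem realize_liftSubst_inr {N : Type} [arith.Structure N]
    (f : α ⊕ Fin n → arith.Term (β ⊕ Fin m)) (v : β → N) (xs : Fin m → N) (y : N) :
    (fun i => (liftSubst f (Sum.inr i)).realize
      (Sum.elim v (Fin.snoc xs y : Fin (m + 1) → N))) =
    (Fin.snoc (fun i => (f (Sum.inr i)).realize (Sum.elim v xs)) y : Fin (n + 1) → N) := by
  funext i
  refine Fin.lastCases ?_ (fun i => ?_) i
  · simp [liftSubst]
  · simp [liftSubst]

theorem realize_subst_elim {N : Type} [arith.Structure N] (t : arith.Term (α ⊕ Fin n))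
    (f : α ⊕ Fin n → arith.Term (β ⊕ Fin m)) (w : β ⊕ Fin m → N) :
    (t.subst f).realize w =
      t.realize (Sum.elim (fun a => (f (Sum.inl a)).realize w)
        (fun i => (f (Sum.inr i)).realize w)) := by
  rw [Term.realize_subst]
  congr 1
  funext i
  cases i <;> rfl

/-- Bounded formulas are closed under substitution of terms for their variables. -/
theorem IsDelta0.exists_subst {φ : arith.BoundedFormula α n} (h : IsDelta0 φ) :
    ∀ {m : ℕ} (f : α ⊕ Fin n → arith.Term (β ⊕ Fin m)),
      ∃ ψ : arith.BoundedFormula β m, IsDelta0 ψ ∧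
        ∀ (N : Type) [arith.Structure N] (v : β → N) (xs : Fin m → N), ψ.Realize v xs ↔
          φ.Realize (fun a => (f (Sum.inl a)).realize (Sum.elim v xs))
            (fun i => (f (Sum.inr i)).realize (Sum.elim v xs)) := by
  induction h with
  | falsum => exact fun f => ⟨_, .falsum, fun N _ v xs => Iff.rfl⟩
  | equal s t =>
    intro m f
    refine ⟨_, .equal (s.subst f) (t.subst f), fun N _ v xs => ?_⟩
    simp only [BoundedFormula.Realize, realize_subst_elim]
  | rel R ts =>
    intro m f
    refine ⟨_, .rel R (fun i => (ts i).subst f), fun N _ v xs => ?_⟩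
    simp only [BoundedFormula.Realize, realize_subst_elim]
  | imp _ _ ih₁ ih₂ =>
    intro m f
    obtain ⟨ψ₁, h₁, e₁⟩ := ih₁ f
    obtain ⟨ψ₂, h₂, e₂⟩ := ih₂ f
    refine ⟨_, h₁.imp h₂, fun N _ v xs => ?_⟩
    rw [BoundedFormula.realize_imp, BoundedFormula.realize_imp, e₁, e₂]
  | ball t _ ih =>
    intro m f
    obtain ⟨ψ, h, e⟩ := ih (liftSubst f)
    refine ⟨_, .ball (t.subst f) h, fun N _ v xs => ?_⟩
    simp only [BoundedFormula.realize_all, BoundedFormula.realize_imp, realize_fLe, e,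
      realize_liftTerm, realize_liftSubst_inl, realize_liftSubst_inr, realize_subst_elim,
      Function.comp_apply, Term.realize_var, Sum.elim_inr, Fin.snoc_last]
  | bex t _ ih =>
    intro m f
    obtain ⟨ψ, h, e⟩ := ih (liftSubst f)
    refine ⟨_, .bex (t.subst f) h, fun N _ v xs => ?_⟩
    simp only [BoundedFormula.realize_ex, BoundedFormula.realize_inf, realize_fLe, e,
      realize_liftTerm, realize_liftSubst_inl, realize_liftSubst_inr, realize_subst_elim,
      Function.comp_apply, Term.realize_var, Sum.elim_inr, Fin.snoc_last]

/-! ### Standard numbers inside a model: absoluteness and Σ₁-completeness -/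

section Absoluteness

variable {M : Type} [arith.Structure M] [M ⊨ PA]

theorem natCast_comp_vec₁ (w : Fin 1 → ℕ) : (fun i => (w i : M)) = ![(w 0 : M)] :=
  funext fun i => by fin_cases i; rfl

theorem natCast_comp_vec₂ (w : Fin 2 → ℕ) : (fun i => (w i : M)) = ![(w 0 : M), (w 1 : M)] :=
  funext fun i => by fin_cases i <;> rfl

theorem funMap_natCast {l : ℕ} (f : arith.Functions l) (w : Fin l → ℕ) :
    Structure.funMap f (fun i => (w i : M)) = ((Structure.funMap f w : ℕ) : M) := by
  cases f with
  | zero =>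
    rw [show (fun i => (w i : M)) = ![] from funext finZeroElim]
    exact Nat.cast_zero.symm
  | succ =>
    rw [natCast_comp_vec₁]
    exact (opSucc_eq _).trans (Nat.cast_succ (w 0)).symm
  | add =>
    rw [natCast_comp_vec₂]
    exact (Nat.cast_add (w 0) (w 1)).symm
  | mul =>
    rw [natCast_comp_vec₂]
    exact (Nat.cast_mul (w 0) (w 1)).symm

theorem relMap_natCast {l : ℕ} (R : arith.Relations l) (w : Fin l → ℕ) :
    Structure.RelMap R (fun i => (w i : M)) ↔ Structure.RelMap R w := by
  cases R with
  | le =>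
    rw [natCast_comp_vec₂]
    exact Nat.cast_le (α := M)

theorem realize_natCast (t : arith.Term α) (v : α → ℕ) :
    t.realize (fun a => (v a : M)) = ((t.realize v : ℕ) : M) := by
  induction t with
  | var a => rfl
  | func f ts ih => simp only [Term.realize, ih, funMap_natCast]

theorem realize_elim_natCast (t : arith.Term (α ⊕ Fin n)) (v : α → ℕ) (xs : Fin n → ℕ) :
    t.realize (Sum.elim (fun a => (v a : M)) fun i => (xs i : M)) =
      ((t.realize (Sum.elim v xs) : ℕ) : M) := by
  rw [← realize_natCast]
  congr 1
  funext i
  cases i <;> rfl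

theorem snoc_natCast (xs : Fin n → ℕ) (k : ℕ) :
    (Fin.snoc (fun i => (xs i : M)) (k : M) : Fin (n + 1) → M) =
      fun i => (((Fin.snoc xs k : Fin (n + 1) → ℕ) i : ℕ) : M) := by
  funext i
  refine Fin.lastCases ?_ (fun i => ?_) i <;> simp

/-- Bounded formulas are absolute between the standard model and any model of arithmetic. -/
theorem IsDelta0.realize_natCast_iff {φ : arith.BoundedFormula α n} (h : IsDelta0 φ) (v : α → ℕ)
    (xs : Fin n → ℕ) :
    φ.Realize (fun a => (v a : M)) (fun i => (xs i : M)) ↔ φ.Realize v xs := by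
  induction h with
  | falsum => exact Iff.rfl
  | equal s t => simp only [BoundedFormula.Realize, realize_elim_natCast, Nat.cast_inj]
  | rel R ts =>
    simp only [BoundedFormula.Realize, realize_elim_natCast]
    exact relMap_natCast R _
  | imp _ _ ih₁ ih₂ => rw [BoundedFormula.realize_imp, BoundedFormula.realize_imp, ih₁, ih₂]
  | ball t _ ih =>
    simp only [BoundedFormula.realize_all, BoundedFormula.realize_imp, realize_fLe,
      realize_liftTerm, Function.comp_apply, Term.realize_var, Sum.elim_inr, Fin.snoc_last,
      realize_elim_natCast, opLe_eq, nat_opLe]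
    refine ⟨fun H k hk => ?_, fun H a ha => ?_⟩
    · rw [← ih, ← snoc_natCast]
      exact H k (Nat.cast_le.2 hk)
    · obtain ⟨k, hk, rfl⟩ := exists_nat_of_le ha
      rw [snoc_natCast, ih]
      exact H k hk
  | bex t _ ih =>
    simp only [BoundedFormula.realize_ex, BoundedFormula.realize_inf, realize_fLe,
      realize_liftTerm, Function.comp_apply, Term.realize_var, Sum.elim_inr, Fin.snoc_last,
      realize_elim_natCast, opLe_eq, nat_opLe]
    refine ⟨fun ⟨a, ha, H⟩ => ?_, fun ⟨k, hk, H⟩ => ⟨k, Nat.cast_le.2 hk, ?_⟩⟩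
    · obtain ⟨k, hk, rfl⟩ := exists_nat_of_le ha
      rw [snoc_natCast, ih] at H
      exact ⟨k, hk, H⟩
    · rw [snoc_natCast, ih]
      exact H

/-- Σ₁-completeness: standard witnesses remain witnesses in `M`. The converse fails, as the
witnesses in `M` may be nonstandard. -/
theorem IsSigma1.realize_natCast_of_realize {φ : arith.BoundedFormula α n} (h : IsSigma1 φ)
    (v : α → ℕ) (xs : Fin n → ℕ) (H : φ.Realize v xs) :
    φ.Realize (fun a => (v a : M)) (fun i => (xs i : M)) := by
  induction h with
  | of_delta0 h => exact (h.realize_natCast_iff v xs).2 H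
  | ex _ ih =>
    obtain ⟨k, hk⟩ := BoundedFormula.realize_ex.1 H
    refine BoundedFormula.realize_ex.2 ⟨k, ?_⟩
    rw [snoc_natCast]
    exact ih _ hk

end Absoluteness

theorem IsPi1.exists_not {φ : arith.BoundedFormula α n} (h : IsPi1 φ) :
    ∃ ψ : arith.BoundedFormula α n, IsSigma1 ψ ∧
      ∀ (N : Type) [arith.Structure N] (v : α → N) (xs : Fin n → N),
        ψ.Realize v xs ↔ ¬ φ.Realize v xs := by
  induction h with
  | of_delta0 h => exact ⟨_, .of_delta0 h.not, fun N _ v xs => BoundedFormula.realize_not⟩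
  | all _ ih =>
    obtain ⟨ψ, hψ, e⟩ := ih
    refine ⟨_, hψ.ex, fun N _ v xs => ?_⟩
    simp only [BoundedFormula.realize_ex, BoundedFormula.realize_all, e, not_forall]

/-- Existential formulas with a single witness bound: `φ` is equivalent to `∃ t, θ(t)`, where `θ` is
bounded and monotone in `t`. -/
theorem IsSigma1.exists_bound {φ : arith.BoundedFormula α n} (h : IsSigma1 φ) :
    ∃ θ : arith.BoundedFormula (α ⊕ Unit) n, IsDelta0 θ ∧
      ∀ (M : Type) [arith.Structure M] [M ⊨ PA] (v : α → M) (xs : Fin n → M),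
        (φ.Realize v xs ↔ ∃ t : M, θ.Realize (Sum.elim v fun _ => t) xs) ∧
        ∀ s t : M, opLe s t → θ.Realize (Sum.elim v fun _ => s) xs →
          θ.Realize (Sum.elim v fun _ => t) xs := by
  induction h with
  | of_delta0 h =>
    obtain ⟨θ, hθ, e⟩ := h.exists_subst (β := _ ⊕ Unit)
      (Sum.elim (fun a => Term.var (Sum.inl (Sum.inl a))) fun i => Term.var (Sum.inr i))
    refine ⟨θ, hθ, fun M _ _ v xs => ?_⟩
    simp only [e, Sum.elim_inl, Sum.elim_inr, Term.realize_var]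
    exact ⟨⟨fun H => ⟨0, H⟩, fun ⟨_, H⟩ => H⟩, fun _ _ _ H => H⟩
  | ex _ ih =>
    obtain ⟨θ, hθ, e⟩ := ih
    -- The parameter t now bounds the outer quantifier as well; monotonicity allows t to be raised
    -- to the maximum of the old bound and the new witness.
    refine ⟨_, .bex (Term.var (Sum.inl (Sum.inr ()))) hθ, fun M _ _ v xs => ?_⟩
    simp only [BoundedFormula.realize_ex, BoundedFormula.realize_inf, realize_fLe,
      realize_liftTerm, Function.comp_apply, Term.realize_var, Sum.elim_inr, Sum.elim_inl,
      Fin.snoc_last, (e M v _).1]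
    refine ⟨⟨fun ⟨a, t, H⟩ => ?_, fun ⟨t, a, _, H⟩ => ⟨a, t, H⟩⟩, ?_⟩
    · exact ⟨max a t, a, le_max_left a t, (e M v _).2 t _ (le_max_right a t) H⟩
    · rintro s t hst ⟨a, ha, H⟩
      exact ⟨a, le_trans (α := M) ha hst, (e M v _).2 s t hst H⟩

/-- The negation of `χ ∧ φ(f)`, for bounded `χ`, existential `φ` and a substitution `f`, is
universal. -/
theorem IsSigma1.exists_pi1_not {φ : arith.BoundedFormula α n} (h : IsSigma1 φ) :
    ∀ {m : ℕ} (f : α ⊕ Fin n → arith.Term (β ⊕ Fin m)) {χ : arith.BoundedFormula β m},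
      IsDelta0 χ → ∃ ψ : arith.BoundedFormula β m, IsPi1 ψ ∧
        ∀ (N : Type) [arith.Structure N] (v : β → N) (xs : Fin m → N), ψ.Realize v xs ↔
          ¬ (χ.Realize v xs ∧ φ.Realize (fun a => (f (Sum.inl a)).realize (Sum.elim v xs))
            (fun i => (f (Sum.inr i)).realize (Sum.elim v xs))) := by
  induction h with
  | of_delta0 h =>
    intro m f χ hχ
    obtain ⟨ψ, hψ, e⟩ := h.exists_subst f
    refine ⟨_, .of_delta0 (hχ.inf hψ).not, fun N _ v xs => ?_⟩
    rw [BoundedFormula.realize_not, BoundedFormula.realize_inf, e]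
  | ex _ ih =>
    intro m f χ hχ
    obtain ⟨χ', hχ', e'⟩ := hχ.exists_subst (m := m + 1)
      (Sum.elim (fun a => Term.var (Sum.inl a)) fun i => Term.var (Sum.inr i.castSucc))
    -- The conjunct χ is carried under the quantifier, which keeps the result prenex, as `IsPi1`
    -- requires.
    obtain ⟨ψ, hψ, e⟩ := ih (liftSubst f) hχ'
    refine ⟨_, hψ.all, fun N _ v xs => ?_⟩
    simp only [BoundedFormula.realize_ex, BoundedFormula.realize_all, e, e',
      realize_liftSubst_inl, realize_liftSubst_inr, Sum.elim_inl, Sum.elim_inr, Term.realize_var,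
      Fin.snoc_castSucc, ← not_exists, exists_and_left]

end Delta0

/-! ### Codes of strings and the complexity -/

theorem strCode_append (s : List Bool) (b : Bool) :
    strCode (s ++ [b]) = 2 * strCode s + 1 + b.toNat := by
  simp [strCode]

theorem two_pow_length_le (s : List Bool) : 2 ^ s.length ≤ strCode s + 1 := by
  induction s using List.reverseRecOn with
  | nil => simp [strCode]
  | append_singleton s b ih =>
    rw [strCode_append, List.length_append, List.length_singleton, pow_succ]
    omega

theorem strCode_lt (s : List Bool) : strCode s + 1 < 2 ^ (s.length + 1) := by
  induction s using List.reverseRecOn with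
  | nil => simp [strCode]
  | append_singleton s b ih =>
    rw [strCode_append, List.length_append, List.length_singleton, pow_succ]
    have := Bool.toNat_le b
    omega

theorem strCode_surjective (m : ℕ) : ∃ s, strCode s = m := by
  induction m using Nat.strong_induction_on with
  | _ m ih =>
    rcases m with _ | m
    · exact ⟨[], rfl⟩
    · obtain ⟨s, hs⟩ := ih (m / 2) (by omega)
      refine ⟨s ++ [decide (m % 2 = 1)], ?_⟩
      rw [strCode_append, hs]
      rcases Nat.mod_two_eq_zero_or_one m with h | h <;> simp [h] <;> omega

theorem complexity_le {U : arith.Formula (Fin 2)} {p x : List Bool} (h : Outputs U p x) :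
    complexity U x ≤ p.length :=
  Nat.sInf_le ⟨p, rfl, h⟩

theorem exists_outputs_of_exists {U : arith.Formula (Fin 2)} {x : List Bool}
    (h : ∃ p, Outputs U p x) : ∃ p, p.length = complexity U x ∧ Outputs U p x := by
  obtain ⟨p, hp⟩ := h
  exact Nat.sInf_mem (s := {k | ∃ p : List Bool, p.length = k ∧ Outputs U p x}) ⟨_, p, rfl, hp⟩

/-! ### Semantic descriptions of languages -/

section Languages

theorem models_of_forall_realize {σ : arith.Sentence}
    (h : ∀ (M : Type) [arith.Structure M] [M ⊨ PA], M ⊨ σ) : PA ⊨ᵇ σ :=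
  Theory.models_sentence_iff.2 fun M => h M

/-- By completeness, provability in PA may be checked in all models, where the order and the
semiring structure are available. -/
theorem isPrefixLanguage_of_models {V : arith.Formula (Fin 2)} (hV : IsSigma1 V)
    (hfun : ∀ (M : Type) [arith.Structure M] [M ⊨ PA] (p x y : M),
      V.Realize ![p, x] → V.Realize ![p, y] → x = y)
    (hpre : ∀ (M : Type) [arith.Structure M] [M ⊨ PA] (p q x y R r : M),
      V.Realize ![p, x] → V.Realize ![q, y] → IsPow R → r < R → q + 1 = (p + 1) * R + r →
      p = q) : IsPrefixLanguage V where
  sigma1 := hV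
  functional := models_of_forall_realize fun M _ _ => by
    simp only [Sentence.Realize, Formula.Realize, BoundedFormula.realize_all,
      BoundedFormula.realize_imp, realize_app₂, realize_fEq]
    exact fun p x y => hfun M p x y
  prefixFree := models_of_forall_realize fun M _ _ => by
    simp only [Sentence.Realize, Formula.Realize, BoundedFormula.realize_all,
      BoundedFormula.realize_imp, realize_app₂, realize_fEq, isPrefix, BoundedFormula.realize_ex,
      BoundedFormula.realize_inf, realize_isPowTwo, realize_fLt, realize_tSucc, realize_liftTerm,
      realize_tAdd, realize_tMul, Function.comp_apply, Term.realize_var, Sum.elim_inr,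
      Fin.snoc_last, Fin.snoc_castSucc, opSucc_eq, opAdd_eq, opMul_eq, opLe_eq, add_one_le_iff_lt]
    rintro p q x y hp hq ⟨R, hR, r, hr, h⟩
    exact hpre M p q x y R r hp hq hR hr h

variable {M : Type} [arith.Structure M] [M ⊨ PA] {U : arith.Formula (Fin 2)}

theorem IsLanguage.eq_of_realize (hU : IsLanguage U) {p x y : M} (hx : U.Realize ![p, x])
    (hy : U.Realize ![p, y]) : x = y := by
  have h := hU.functional.realize_sentence M
  simp only [Sentence.Realize, Formula.Realize, BoundedFormula.realize_all,
    BoundedFormula.realize_imp, realize_app₂, realize_fEq] at h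
  exact h p x y hx hy

theorem ComplexityLeAdd.exists_realize {V : arith.Formula (Fin 2)} {c : ℕ}
    (h : ComplexityLeAdd U V c) {p x : M} (hp : V.Realize ![p, x]) :
    ∃ q : M, (∀ R : M, IsPow R → p + 1 < R → q + 1 < (2 ^ c : ℕ) * R) ∧ U.Realize ![q, x] := by
  have h := Theory.ModelsBoundedFormula.realize_sentence h M
  simp only [Sentence.Realize, Formula.Realize, BoundedFormula.realize_all,
    BoundedFormula.realize_imp, realize_app₂, lenLeAdd, BoundedFormula.realize_ex,
    BoundedFormula.realize_inf, realize_isPowTwo, realize_fLt, realize_tSucc, realize_liftTerm,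
    realize_tMul, realize_numeral, Function.comp_apply, Term.realize_var, Sum.elim_inr,
    Fin.snoc_last, opSucc_eq, opMul_eq, opNum_eq, opLe_eq, add_one_le_iff_lt] at h
  exact h p x hp

theorem realize_sentKLt (x : List Bool) (k : ℕ) :
    M ⊨ sentKLt U x k ↔
      ∃ q : M, q + 1 < (2 ^ k : ℕ) ∧ U.Realize ![q, (strCode x : M)] := by
  simp only [sentKLt, Sentence.Realize, Formula.Realize, BoundedFormula.realize_ex,
    BoundedFormula.realize_inf, realize_fLt, realize_tSucc, realize_numeral, realize_app₂,
    opSucc_eq, opNum_eq, opLe_eq, add_one_le_iff_lt]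
  rfl

end Languages

/-! ### The language that exploits a counterexample to a universal sentence -/

section Refuting

variable {N : Type} [arith.Structure N] {β : Type} {m : ℕ}

/-- `U(q, x)` with witnesses bounded by `t`, where `θ` is the bounded form of `U`. -/
def HaltsWithin (θ : arith.BoundedFormula (Fin 2 ⊕ Unit) 0) (q x t : N) : Prop :=
  θ.Realize (Sum.elim ![q, x] fun _ => t) default

/-- There is a counterexample bounded by `t`, where `C` is the bounded form of its existence. -/
def RefutedWithin (C : arith.BoundedFormula (Empty ⊕ Unit) 0) (t : N) : Prop :=
  C.Realize (fun _ => t) default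

/-- No program `q ≤ p ^ 4` outputs `x` with witnesses bounded by `t`. -/
def NoShortProgram (θ : arith.BoundedFormula (Fin 2 ⊕ Unit) 0) (p x t : N) : Prop :=
  ∀ q, opLe q (opMul (opMul p p) (opMul p p)) → ¬ HaltsWithin θ q x t

/-- The bounded version of `IsPow`. -/
def IsPowBdd (P : N) : Prop :=
  ∀ d, opLe d P → ∀ e, opLe e P → opMul d e = P → d = opNum 1 ∨ ∃ h, opLe h d ∧ d = opAdd h h

/-- `t` is the least bound for a counterexample, `p ≥ 2` is a power of two and `x` is the least
string that has no program `q ≤ p ^ 4` that terminates within `t`. -/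
def IsRefuterOutput (θ : arith.BoundedFormula (Fin 2 ⊕ Unit) 0)
    (C : arith.BoundedFormula (Empty ⊕ Unit) 0) (p x t : N) : Prop :=
  RefutedWithin C t ∧ (∀ s, opLe s t → RefutedWithin C s → opLe t s) ∧
    IsPowBdd p ∧ opLe (opNum 2) p ∧
    NoShortProgram θ p x t ∧ ∀ y, opLe y x → NoShortProgram θ p y t → opLe x y

theorem exists_delta0_haltsWithin {θ : arith.BoundedFormula (Fin 2 ⊕ Unit) 0} (hθ : IsDelta0 θ)
    (q x t : arith.Term (β ⊕ Fin m)) :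
    ∃ ψ : arith.BoundedFormula β m, IsDelta0 ψ ∧
      ∀ (N : Type) [arith.Structure N] (v : β → N) (xs : Fin m → N), ψ.Realize v xs ↔
        HaltsWithin θ (q.realize (Sum.elim v xs)) (x.realize (Sum.elim v xs))
          (t.realize (Sum.elim v xs)) := by
  obtain ⟨ψ, hψ, e⟩ := hθ.exists_subst
    (Sum.elim (Sum.elim ![q, x] fun _ => t) finZeroElim : (Fin 2 ⊕ Unit) ⊕ Fin 0 → _)
  refine ⟨ψ, hψ, fun N _ v xs => (e N v xs).trans ?_⟩
  rw [HaltsWithin, iff_iff_eq]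
  congr 1
  · funext i
    rcases i with i | i
    · fin_cases i <;> rfl
    · rfl
  · exact funext finZeroElim

theorem exists_delta0_refutedWithin {C : arith.BoundedFormula (Empty ⊕ Unit) 0} (hC : IsDelta0 C)
    (t : arith.Term (β ⊕ Fin m)) :
    ∃ ψ : arith.BoundedFormula β m, IsDelta0 ψ ∧
      ∀ (N : Type) [arith.Structure N] (v : β → N) (xs : Fin m → N), ψ.Realize v xs ↔
        RefutedWithin C (t.realize (Sum.elim v xs)) := by
  obtain ⟨ψ, hψ, e⟩ := hC.exists_subst (fun _ => t)
  refine ⟨ψ, hψ, fun N _ v xs => (e N v xs).trans ?_⟩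
  rw [RefutedWithin, iff_iff_eq]
  congr 1
  exact funext finZeroElim

theorem exists_delta0_noShortProgram {θ : arith.BoundedFormula (Fin 2 ⊕ Unit) 0}
    (hθ : IsDelta0 θ) (p x t : arith.Term (β ⊕ Fin m)) :
    ∃ ψ : arith.BoundedFormula β m, IsDelta0 ψ ∧
      ∀ (N : Type) [arith.Structure N] (v : β → N) (xs : Fin m → N), ψ.Realize v xs ↔
        NoShortProgram θ (p.realize (Sum.elim v xs)) (x.realize (Sum.elim v xs))
          (t.realize (Sum.elim v xs)) := by
  obtain ⟨ψ, hψ, e⟩ := exists_delta0_haltsWithin hθ (&(Fin.last m)) (liftTerm x) (liftTerm t)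
  refine ⟨_, .ball (tMul (tMul p p) (tMul p p)) hψ.not, fun N _ v xs => ?_⟩
  simp only [NoShortProgram, BoundedFormula.realize_all, BoundedFormula.realize_imp,
    BoundedFormula.realize_not, realize_fLe, e, realize_liftTerm, realize_tMul,
    Function.comp_apply, Term.realize_var, Sum.elim_inr, Fin.snoc_last]

theorem exists_delta0_isPowBdd (P : arith.Term (β ⊕ Fin m)) :
    ∃ ψ : arith.BoundedFormula β m, IsDelta0 ψ ∧
      ∀ (N : Type) [arith.Structure N] (v : β → N) (xs : Fin m → N), ψ.Realize v xs ↔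
        IsPowBdd (P.realize (Sum.elim v xs)) := by
  have h1 := IsDelta0.bex (α := β) (n := m + 2) (&((Fin.last m).castSucc))
    (isDelta0_fEq (&((Fin.last m).castSucc.castSucc))
      (tAdd (&(Fin.last (m + 2))) (&(Fin.last (m + 2)))))
  have h2 := (isDelta0_fEq (α := β) (n := m + 2) (&((Fin.last m).castSucc)) (numeral 1)).sup h1
  have h3 := (isDelta0_fEq (tMul (&((Fin.last m).castSucc)) (&(Fin.last (m + 1))))
    (liftTerm (liftTerm P))).imp h2
  refine ⟨_, .ball P (.ball (liftTerm P) h3), fun N _ v xs => ?_⟩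
  simp only [IsPowBdd, BoundedFormula.realize_all, BoundedFormula.realize_imp,
    BoundedFormula.realize_ex, BoundedFormula.realize_inf, BoundedFormula.realize_sup,
    realize_fLe, realize_fEq, realize_liftTerm, realize_tMul, realize_tAdd, realize_numeral,
    Function.comp_apply, Term.realize_var, Sum.elim_inr, Fin.snoc_last, Fin.snoc_castSucc]

/-- In `IsRefuterOutput` every quantifier is bounded by a term in p, x, t; this is why minimality is
stated only against smaller elements and `IsPowBdd` replaces `IsPow`. The only unbounded quantifier
is the one over t. -/
theorem exists_sigma1_refuter {θ : arith.BoundedFormula (Fin 2 ⊕ Unit) 0} (hθ : IsDelta0 θ)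
    {C : arith.BoundedFormula (Empty ⊕ Unit) 0} (hC : IsDelta0 C) :
    ∃ V : arith.Formula (Fin 2), IsSigma1 V ∧
      ∀ (N : Type) [arith.Structure N] (p x : N),
        V.Realize ![p, x] ↔ ∃ t, IsRefuterOutput θ C p x t := by
  let p : ∀ k : ℕ, arith.Term (Fin 2 ⊕ Fin k) := fun _ => Term.var (Sum.inl 0)
  let x : ∀ k : ℕ, arith.Term (Fin 2 ⊕ Fin k) := fun _ => Term.var (Sum.inl 1)
  obtain ⟨ψ₁, h₁, e₁⟩ := exists_delta0_refutedWithin hC (&0 : arith.Term (Fin 2 ⊕ Fin 1))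
  obtain ⟨ψ₂, h₂, e₂⟩ := exists_delta0_refutedWithin hC (&1 : arith.Term (Fin 2 ⊕ Fin 2))
  obtain ⟨ψ₃, h₃, e₃⟩ := exists_delta0_isPowBdd (p 1)
  obtain ⟨ψ₄, h₄, e₄⟩ := exists_delta0_noShortProgram hθ (p 1) (x 1) (&0)
  obtain ⟨ψ₅, h₅, e₅⟩ := exists_delta0_noShortProgram hθ (p 2) (&1) (&0)
  have h := h₁.inf <| (IsDelta0.ball (&0) (h₂.imp (isDelta0_fLe (&0) (&1)))).inf <| h₃.inf <|
    (isDelta0_fLe (numeral 2) (p 1)).inf <| h₄.inf <|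
    IsDelta0.ball (x 1) (h₅.imp (isDelta0_fLe (x 2) (&1)))
  refine ⟨_, (IsSigma1.of_delta0 h).ex, fun N _ a b => ?_⟩
  simp only [IsRefuterOutput, Formula.Realize, BoundedFormula.realize_all,
    BoundedFormula.realize_imp, BoundedFormula.realize_ex, BoundedFormula.realize_inf,
    realize_fLe, realize_liftTerm, realize_numeral, Term.realize_var, e₁, e₂, e₃, e₄, e₅,
    Sum.elim_inl, Sum.elim_inr, Function.comp_apply, p, x]
  rfl

variable {M : Type} [arith.Structure M] [M ⊨ PA]

/-- Divisors of P ≠ 0 are at most P. For P = 0 the bounded version holds vacuously of odd numbers,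
while `IsPow` fails. -/
theorem isPowBdd_iff {P : M} (hP : P ≠ 0) : IsPowBdd P ↔ IsPow P := by
  simp only [IsPowBdd, IsPow, opMul_eq, opLe_eq, opAdd_eq]
  refine ⟨fun H d e h => ?_, fun H d _ e _ h => ?_⟩
  · have one_le : ∀ a : M, a ≠ 0 → 1 ≤ a := fun a ha => by
      simpa using add_one_le_iff_lt.2 (pos_iff_ne_zero.2 ha)
    have hd : 1 ≤ d := one_le d (by rintro rfl; exact hP (by rw [← h, zero_mul]))
    have he : 1 ≤ e := one_le e (by rintro rfl; exact hP (by rw [← h, mul_zero]))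
    refine (H d (h ▸ le_mul_of_one_le_right zero_le he) e
      (h ▸ le_mul_of_one_le_left zero_le hd) h).imp_right ?_
    exact fun ⟨k, _, hk⟩ => ⟨k, hk⟩
  · exact (H d e h).imp_right fun ⟨k, hk⟩ => ⟨k, by rw [hk]; exact le_self_add, hk⟩

/-- Outputs are unique because t and x are both least; prefix-freeness is `IsPow.eq_of_prefix`. Both
hold in every model, whether or not a counterexample exists there. -/
theorem isPrefixLanguage_of_realize_iff_refuter {θ : arith.BoundedFormula (Fin 2 ⊕ Unit) 0}
    {C : arith.BoundedFormula (Empty ⊕ Unit) 0} {V : arith.Formula (Fin 2)} (hV : IsSigma1 V)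
    (e : ∀ (N : Type) [arith.Structure N] (p x : N),
      V.Realize ![p, x] ↔ ∃ t, IsRefuterOutput θ C p x t) : IsPrefixLanguage V := by
  refine isPrefixLanguage_of_models hV (fun M _ _ p x y hx hy => ?_)
    (fun M _ _ p q x y R r hx hy hR hr h => ?_)
  · obtain ⟨t, hC, ht, -, -, hx, hmin⟩ := (e M p x).1 hx
    obtain ⟨t', hC', ht', -, -, hy, hmin'⟩ := (e M p y).1 hy
    simp only [opLe_eq] at ht ht' hmin hmin'
    obtain rfl : t = t' := by
      rcases le_total t t' with h | h
      · exact le_antisymm h (ht' t h hC)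
      · exact le_antisymm (ht t' h hC') h
    rcases le_total x y with h | h
    · exact le_antisymm h (hmin' x h hx)
    · exact le_antisymm (hmin y h hy) h
  · obtain ⟨-, -, -, hp, hp2, -⟩ := (e M p x).1 hx
    obtain ⟨-, -, -, hq, hq2, -⟩ := (e M q y).1 hy
    have two_le : ∀ a : M, opLe (opNum 2) a → 2 ≤ a := fun a ha => by
      rw [opNum_eq, opLe_eq] at ha
      exact_mod_cast ha
    have hp0 : p ≠ 0 := (lt_of_lt_of_le two_pos (two_le p hp2)).ne'
    have hq0 : q ≠ 0 := (lt_of_lt_of_le two_pos (two_le q hq2)).ne'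
    exact ((isPowBdd_iff hp0).1 hp).eq_of_prefix ((isPowBdd_iff hq0).1 hq) hR (two_le p hp2) hr h

/-- A standard string without programs below a standard bound exists by counting. -/
theorem exists_least_noShortProgram {U : arith.Formula (Fin 2)} (hU : IsLanguage U)
    {θ : arith.BoundedFormula (Fin 2 ⊕ Unit) 0}
    (hθ : ∀ q x t : M, HaltsWithin θ q x t → U.Realize ![q, x]) (P : ℕ) (t : M) :
    ∃ x : ℕ, NoShortProgram θ (P : M) x t ∧
      ∀ y : M, y ≤ x → NoShortProgram θ (P : M) y t → (x : M) ≤ y := by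
  classical
  have hex : ∃ x : ℕ, NoShortProgram θ (P : M) x t := by
    by_contra! hcon
    have hcon' : ∀ x : ℕ, ∃ k : ℕ, k ≤ P * P * (P * P) ∧ U.Realize ![(k : M), (x : M)] := by
      intro x
      have := hcon x
      simp only [NoShortProgram, opMul_eq, opLe_eq, not_forall, not_not] at this
      obtain ⟨q, hq, h⟩ := this
      obtain ⟨k, hk, rfl⟩ := exists_nat_of_le (n := P * P * (P * P)) (by exact_mod_cast hq)
      exact ⟨k, hk, hθ _ _ _ h⟩
    choose f hf hfU using hcon'
    -- Pigeonhole: only P^4 + 1 codes are available, all standard, so two distinct standard strings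
    -- would share a program.
    obtain ⟨a, b, hab, h⟩ := Finite.exists_ne_map_eq_of_infinite
      (fun x => (⟨f x, Nat.lt_succ_of_le (hf x)⟩ : Fin (P * P * (P * P) + 1)))
    have hfab : f a = f b := congrArg Fin.val h
    refine hab (Nat.cast_injective (R := M) (hU.eq_of_realize (hfU a) ?_))
    rw [hfab]
    exact hfU b
  refine ⟨Nat.find hex, Nat.find_spec hex, fun y hy h => ?_⟩
  obtain ⟨k, -, rfl⟩ := exists_nat_of_le hy
  exact Nat.cast_le.2 (Nat.find_min' hex h)

end Refuting

/-! ### Optimal languages -/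

section Optimal

variable {U : arith.Formula (Fin 2)}

/-- An optimal language describes every string: compare it with the language in which the empty
program outputs `x`. -/
theorem exists_outputs (hopt : ∀ V, IsPrefixLanguage V → ∃ c, ComplexityLeAdd U V c)
    (x : List Bool) : ∃ p, Outputs U p x := by
  let V : arith.Formula (Fin 2) :=
    fEq (n := 0) (Term.var (Sum.inl 0)) tZero ⊓
      fEq (n := 0) (Term.var (Sum.inl 1)) (numeral (strCode x))
  have hV : ∀ (N : Type) [arith.Structure N] (p y : N),
      V.Realize ![p, y] ↔ p = opZero N ∧ y = opNum (strCode x) := fun N _ p y => by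
    simp only [V, Formula.Realize, BoundedFormula.realize_inf, realize_fEq, realize_tZero,
      realize_numeral, Term.realize_var, Sum.elim_inl]
    rfl
  obtain ⟨c, hc⟩ := hopt V <| isPrefixLanguage_of_models
    (.of_delta0 ((isDelta0_fEq _ _).inf (isDelta0_fEq _ _)))
    (fun M _ _ p y z hy hz => ((hV M p y).1 hy).2.trans ((hV M p z).1 hz).2.symm)
    (fun M _ _ p q y z _ _ hy hz _ _ _ => ((hV M p y).1 hy).1.trans ((hV M q z).1 hz).1.symm)
  have := nat_models_PA
  obtain ⟨q, -, hq⟩ := hc.exists_realize ((hV ℕ (opZero ℕ) (opNum (strCode x))).2 ⟨rfl, rfl⟩)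
  obtain ⟨p, rfl⟩ := strCode_surjective q
  rw [nat_opNum] at hq
  exact ⟨p, hq⟩

theorem not_realize_of_lt_two_pow {x : List Bool} {k : ℕ} (hk : k ≤ complexity U x) {q : ℕ}
    (hq : q + 1 < 2 ^ k) : ¬ U.Realize ![q, strCode x] := by
  intro h
  obtain ⟨p, rfl⟩ := strCode_surjective q
  have h1 := (two_pow_length_le p).trans_lt hq
  rw [Nat.pow_lt_pow_iff_right Nat.one_lt_two] at h1
  exact absurd (h1.trans_le hk) (not_lt.2 (complexity_le h))

variable {M : Type} [arith.Structure M] [M ⊨ PA]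

theorem IsSigma1.realize_natCast₂ (hU : IsSigma1 U) {a b : ℕ} (h : U.Realize ![a, b]) :
    U.Realize ![(a : M), (b : M)] := by
  have := hU.realize_natCast_of_realize (M := M) ![a, b] _ h
  rw [Formula.Realize]
  convert this using 1
  funext i
  fin_cases i <;> rfl

theorem realize_sentKLe_complexity (hU : IsSigma1 U) {x : List Bool} (hx : ∃ p, Outputs U p x) :
    M ⊨ sentKLe U x (complexity U x) := by
  obtain ⟨p, hp, h⟩ := exists_outputs_of_exists hx
  refine (realize_sentKLt x _).2 ⟨strCode p, ?_, hU.realize_natCast₂ h⟩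
  have := strCode_lt p
  rw [hp] at this
  exact_mod_cast this

/-- True lower bounds on the complexity follow from the true universal sentences. -/
theorem not_realize_sentKLt (hU : IsSigma1 U) (hM : ∀ σ ∈ trueUniversal, M ⊨ σ) {x : List Bool}
    {k : ℕ} (hk : k ≤ complexity U x) : ¬ M ⊨ sentKLt U x k := by
  obtain ⟨ψ, hψ, e⟩ := hU.exists_pi1_not (β := Empty) (m := 1)
    (Sum.elim ![&0, numeral (strCode x)] finZeroElim)
    (isDelta0_fLe (tSucc (tSucc (&0))) (numeral (2 ^ k)))
  have e' : ∀ (N : Type) [arith.Structure N], N ⊨ (∀' ψ : arith.Sentence) ↔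
      ∀ q : N, ¬ (opLe (opSucc (opSucc q)) (opNum (2 ^ k)) ∧
        U.Realize ![q, opNum (strCode x)]) := by
    intro N _
    refine BoundedFormula.realize_all.trans (forall_congr' fun q => ?_)
    rw [e, realize_fLe, realize_tSucc, realize_tSucc, realize_numeral, Formula.Realize,
      not_iff_not]
    refine and_congr Iff.rfl (iff_iff_eq.2 ?_)
    congr 1
    · funext i
      fin_cases i
      · rfl
      · exact realize_numeral _ _
    · exact funext finZeroElim
  have hN : ℕ ⊨ (∀' ψ : arith.Sentence) := by
    refine (e' ℕ).2 fun q ⟨hq, h⟩ => not_realize_of_lt_two_pow hk ?_ ?_ (q := q)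
    · rwa [nat_opNum, nat_opSucc, nat_opSucc, nat_opLe] at hq
    · rwa [nat_opNum] at h
  have hMψ := (e' M).1 (hM _ ⟨hψ.all, hN⟩)
  rw [realize_sentKLt]
  rintro ⟨q, hq, h⟩
  refine hMψ q ⟨?_, by rwa [opNum_eq]⟩
  rwa [opNum_eq, opSucc_eq, opSucc_eq, opLe_eq, add_one_le_iff_lt]

/-- A model of arithmetic that satisfies lower bounds `K(x) > c x ≥ K(x) / 2` satisfies all true
universal sentences. Otherwise the nonstandard counterexample bounds the running time of all standard
terminating programs, which lets one generate strings of large complexity by short programs. -/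
theorem realize_of_lowerBounds (hU : IsLanguage U)
    (hopt : ∀ V, IsPrefixLanguage V → ∃ c, ComplexityLeAdd U V c) (c : List Bool → ℝ)
    (hc : ∀ x, 0 < complexity U x → (complexity U x : ℝ) / 2 ≤ c x)
    (hM : ∀ x, 0 < complexity U x → ¬ M ⊨ sentKLe U x ⌊c x⌋₊)
    {σ : arith.Sentence} (hσ : IsPi1 σ) (hN : ℕ ⊨ σ) : M ⊨ σ := by
  by_contra hσM
  obtain ⟨ψ, hψ, eψ⟩ := hσ.exists_not
  obtain ⟨C, hC, eC⟩ := hψ.exists_bound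
  obtain ⟨θ, hθ, eθ⟩ := hU.sigma1.exists_bound
  have eC' : ∀ (M : Type) [arith.Structure M] [M ⊨ PA],
      ¬ M ⊨ σ ↔ ∃ t : M, RefutedWithin C t := fun M _ _ => by
    refine (eψ M default default).symm.trans ((eC M default default).1.trans ?_)
    refine exists_congr fun t => iff_iff_eq.2 ?_
    rw [RefutedWithin]
    congr 1
    funext i
    rcases i with i | i
    · exact i.elim
    · rfl
  obtain ⟨t₀, ht₀⟩ := (eC' M).1 hσM
  obtain ⟨χ, -, eχ⟩ := exists_delta0_refutedWithin hC (&0 : arith.Term (Empty ⊕ Fin 1))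
  obtain ⟨t, ht, htmin⟩ := exists_least (n := 0) χ ![] (RefutedWithin C)
    (fun y => eχ M default _) ht₀
  -- If t were below a standard number, it would be standard itself, and by absoluteness σ would
  -- fail in ℕ.
  have ht_nonstd : ∀ k : ℕ, (k : M) ≤ t := by
    intro k
    by_contra! hk
    obtain ⟨j, -, rfl⟩ := exists_nat_of_le hk.le
    have := nat_models_PA
    refine (eC' ℕ).2 ⟨j, ?_⟩ hN
    refine (hC.realize_natCast_iff (M := M) (fun _ => j) _).1 ?_
    rw [RefutedWithin] at ht
    convert ht using 1
  obtain ⟨V, hV, eV⟩ := exists_sigma1_refuter hθ hC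
  obtain ⟨m, hm⟩ := hopt V (isPrefixLanguage_of_realize_iff_refuter hV eV)
  have hhalt : ∀ (M : Type) [arith.Structure M] [M ⊨ PA] (q x : M),
      U.Realize ![q, x] ↔ ∃ t, HaltsWithin θ q x t := fun M _ _ q x => (eθ M ![q, x] default).1
  -- The `V`-program 2^(m+1) has length m + 1, just above the overhead m; its fourth power bounds
  -- the codes of all programs of length less than 4m + 4.
  obtain ⟨x, hx, hxmin⟩ := exists_least_noShortProgram hU
    (fun q x t h => (hhalt M q x).2 ⟨t, h⟩) (2 ^ (m + 1)) t
  obtain ⟨s, rfl⟩ := strCode_surjective x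
  have htrue : ∀ p, Outputs U p s → 4 * m + 4 ≤ p.length := by
    intro p hp
    by_contra! hlt
    have := nat_models_PA
    obtain ⟨w, hw⟩ := (hhalt ℕ _ _).1 hp
    have hbound : strCode p ≤ 2 ^ (m + 1) * 2 ^ (m + 1) * (2 ^ (m + 1) * 2 ^ (m + 1)) := by
      have h1 := strCode_lt p
      have h2 : 2 ^ (p.length + 1) ≤ 2 ^ (4 * m + 4) := Nat.pow_le_pow_right two_pos hlt
      have h3 : 2 ^ (4 * m + 4) =
        2 ^ (m + 1) * 2 ^ (m + 1) * (2 ^ (m + 1) * 2 ^ (m + 1)) := by ring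
      omega
    -- The true computation has a standard witness bound w ≤ t, so by absoluteness and monotonicity
    -- it also terminates within t in `M`.
    refine hx (strCode p) ?_ ((eθ M ![(strCode p : M), (strCode s : M)] default).2 w t
      (ht_nonstd w) ?_)
    · rw [opMul_eq, opMul_eq, opLe_eq]
      exact_mod_cast hbound
    · have := (hθ.realize_natCast_iff (M := M) _ _).2 hw
      convert this using 1
      funext i
      rcases i with i | i
      · fin_cases i <;> rfl
      · rfl
  have hK : 4 * m + 4 ≤ complexity U s := by
    obtain ⟨p, hp, h⟩ := exists_outputs_of_exists (exists_outputs hopt s)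
    exact hp ▸ htrue p h
  have hfloor : 2 * m + 2 ≤ ⌊c s⌋₊ := by
    refine Nat.le_floor (le_trans ?_ (hc s (by omega)))
    have : ((4 * m + 4 : ℕ) : ℝ) ≤ complexity U s := Nat.cast_le.2 hK
    push_cast at this ⊢
    linarith
  have hP2 : 2 ≤ 2 ^ (m + 1) := Nat.le_self_pow (by omega) 2
  obtain ⟨q, hq, hqU⟩ := hm.exists_realize (p := ((2 ^ (m + 1) : ℕ) : M)) (x := (strCode s : M))
    ((eV M _ _).2 ⟨t, ht, fun r _ hr => htmin r hr,
      (isPowBdd_iff (isPow_two_pow _).ne_zero).2 (isPow_two_pow _),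
      by rw [opNum_eq, opLe_eq]; exact Nat.cast_le.2 hP2, hx, hxmin⟩)
  refine hM s (by omega) ((realize_sentKLt s _).2 ⟨q, ?_, hqU⟩)
  -- 2^(m+2) is a power of two above 2^(m+1) + 1, which gives q + 1 < 2^m · 2^(m+2) = 2^(2m+2), that
  -- is, |q| ≤ 2m + 1.
  have hq' := hq ((2 ^ (m + 2) : ℕ) : M) (isPow_two_pow _) (by
    rw [← Nat.cast_succ, Nat.cast_lt, pow_succ 2 (m + 1)]
    omega)
  refine hq'.trans_le ?_
  rw [← Nat.cast_mul, Nat.cast_le, ← pow_add]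
  exact Nat.pow_le_pow_right two_pos (by omega)

end Optimal

theorem sameTheorems_of_models {A B : arith.Theory}
    (h : ∀ (M : Type) [arith.Structure M] [M ⊨ PA], (∀ σ ∈ A, M ⊨ σ) ↔ ∀ σ ∈ B, M ⊨ σ) :
    SameTheorems (PA ∪ A) (PA ∪ B) := by
  have key : ∀ {A B : arith.Theory} (_ : ∀ (M : Type) [arith.Structure M] [M ⊨ PA],
      (∀ σ ∈ A, M ⊨ σ) → ∀ σ ∈ B, M ⊨ σ) (τ : arith.Sentence),
      PA ∪ B ⊨ᵇ τ → PA ∪ A ⊨ᵇ τ := by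
    intro A B h τ hτ
    refine Theory.models_sentence_iff.2 fun M => ?_
    have hPA : M ⊨ PA := Theory.Model.mono M.is_model Set.subset_union_left
    have hA : M ⊨ A := Theory.Model.mono M.is_model Set.subset_union_right
    have hB : M ⊨ B := ⟨fun {σ} hσ => h M (fun σ hσ => hA.realize_of_mem σ hσ) σ hσ⟩
    have : M ⊨ PA ∪ B := hPA.union hB
    exact hτ.realize_sentence M
  exact fun τ => ⟨key (fun M _ _ => (h M).2) τ, key (fun M _ _ => (h M).1) τ⟩

end KolmogorovArithmetic

open KolmogorovArithmetic
theorem proposition4 (U : arith.Formula (Fin 2)) (hU : IsOptimalPlain U ∨ IsOptimalPrefix U) :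
    SameTheorems (PA ∪ exactAxioms U) (PA ∪ trueUniversal) ∧
    ∀ c : List Bool → ℝ,
      (∀ x, 0 < complexity U x → (complexity U x : ℝ) / 2 ≤ c x ∧ c x < complexity U x) →
      SameTheorems (PA ∪ lowerBoundAxioms U c) (PA ∪ trueUniversal) := by
  have hlang : IsLanguage U := hU.elim (fun h => h.toIsLanguage) (fun h => h.toIsLanguage)
  have hopt : ∀ V, IsPrefixLanguage V → ∃ c, ComplexityLeAdd U V c :=
    hU.elim (fun h V hV => h.optimal V hV.toIsLanguage) (fun h => h.optimal)
  refine ⟨sameTheorems_of_models fun M _ _ => ⟨?_, ?_⟩,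
    fun c hc => sameTheorems_of_models fun M _ _ => ⟨?_, ?_⟩⟩
  · rintro hM σ ⟨hσ, hN⟩
    -- Here c = K - 1/2, which is at least K/2 when K ≥ 1, and K > ⌊c⌋ = K - 1 is the lower-bound
    -- half of the exact axiom.
    refine realize_of_lowerBounds hlang hopt (fun x => ((complexity U x - 1 : ℕ) : ℝ) + 1 / 2)
      (fun x hx => ?_) (fun x hx => ?_) hσ hN
    · obtain ⟨k, hk⟩ := Nat.exists_eq_succ_of_ne_zero hx.ne'
      simp only [hk, Nat.succ_eq_add_one, Nat.add_sub_cancel]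
      push_cast
      linarith [(Nat.cast_nonneg k : (0 : ℝ) ≤ k)]
    · have h := hM _ ⟨x, rfl⟩
      have hfloor : ⌊((complexity U x - 1 : ℕ) : ℝ) + 1 / 2⌋₊ = complexity U x - 1 := by
        rw [Nat.floor_eq_iff (by positivity)]
        constructor <;> linarith
      rw [hfloor, sentKLe, Nat.sub_add_cancel hx]
      exact (FirstOrder.Language.Sentence.realize_not M).1
        (FirstOrder.Language.BoundedFormula.realize_inf.1 h).2
  · rintro hM σ ⟨x, rfl⟩
    exact FirstOrder.Language.BoundedFormula.realize_inf.2
      ⟨realize_sentKLe_complexity hlang.sigma1 (exists_outputs hopt x),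
        FirstOrder.Language.BoundedFormula.realize_not.2
          (not_realize_sentKLt hlang.sigma1 hM (x := x) le_rfl)⟩
  · rintro hM σ ⟨hσ, hN⟩
    exact realize_of_lowerBounds hlang hopt c (fun x hx => (hc x hx).1)
      (fun x hx => (FirstOrder.Language.Sentence.realize_not M).1 (hM _ ⟨x, hx, rfl⟩)) hσ hN
  · rintro hM σ ⟨x, hx, rfl⟩
    refine (FirstOrder.Language.Sentence.realize_not M).2
      (not_realize_sentKLt hlang.sigma1 hM ?_)
    exact Nat.succ_le_of_lt ((Nat.floor_lt' hx.ne').2 (hc x hx).2)
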